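/- **Coherent Iterative Phase Estimation.** *Setting.* For $n\in\mathbb Z^+$ and $\alpha\in(0,1)$, a unitary $U$ on a finite-dimensional Hilbert space satisfies an $(n,\alpha)$-rounding promise if $U=\sum_j e^{2\pi i\lambda_j}|\psi_j\rangle\langle\psi_j|$ with $(\psi_j)$ an orthonormal basis, $0\le\lambda_j<1$, and $\lambda_j\notin\left[\frac{x}{2^n},\frac{x}{2^n}+\frac{\alpha}{2^n}\right]$ for all $x\in\{0,\dots,2^n\}$ and all $j$. For $0\le k<n$ let $\mathrm{bit}_k(\lambda_j)$ be the $(k+1)$-th least significant bit of the $n$-bit number $\lfloor 2^n\lambda_j\rfloor$, and let $|\Delta_k(\lambda_j)\rangle$ be the $k$-qubit basis state holding its $k$ least significant bits. *Amplifying polynomial.* For $\eta,\delta>0$, an odd $M\ge 1$, and $\kappa=\frac{\sqrt2}{4\eta}\sqrt{\ln\frac{8}{\pi\delta^2}}$ (with $\kappa=0$ if the logarithm is negative), put $$p_{\mathrm{sgn}}(x)=\frac{2\kappa e^{-\kappa^2/2}}{\sqrt\pi}\left(I_0\!\left(\tfrac{\kappa^2}{2}\right)x+\sum_{j=1}^{(M-1)/2}I_j\!\left(\tfrac{\kappa^2}{2}\right)(-1)^j\left(\frac{T_{2j+1}(x)}{2j+1}-\frac{T_{2j-1}(x)}{2j-1}\right)\right),\qquad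 A_{\eta\to\delta}(x)=\frac12-\frac12\,\frac{p_{\mathrm{sgn}}(2x-1)}{1+\delta/2},$$ where $I_j$ are the modified Bessel functions of the first kind and $T_j$ the Chebyshev polynomials of the first kind. Call $M$ *admissible* for $(\eta,\delta)$ if $A_{\eta\to\delta}$ has degree $M$, $0\le A_{\eta\to\delta}\le1$ on $[0,1]$, $A_{\eta\to\delta}\ge1-\delta$ on $[0,\frac12-\eta]$, and $A_{\eta\to\delta}\le\delta$ on $[\frac12+\eta,1]$. An admissible value is denoted $M_{\eta\to\delta}$. *Claim.* 1. There is a universal constant $c>0$ such that for all $0<\eta,\delta<\frac12$ there is an admissible $M_{\eta\to\delta}\le c\,\eta^{-1}\ln(\delta^{-1})$. 2. Let $n\in\mathbb Z^+$, $k\in\{0,\dots,n-1\}$, $\alpha\in(0,1)$, $\delta>0$, $m>0$, and put $\eta=\frac\alpha2$ if $k=0$, $\eta=\frac12-\frac1{2^k}\left(\frac12+\frac\alpha2\right)$ if $k\ge1$, and $\delta_{\mathrm{amp}}=(1-10^{-m})\,\delta^2/8$. For every admissible $M_{\eta\to\delta_{\mathrm{amp}}}$ (by part 1 these exist whenever $\delta_{\mathrm{amp}}<\frac12$,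 in particular for all $\delta\le2$) there is a quantum circuit, not depending on $U$ or on the system it acts on, which consists of one- and two-qubit gates on one output qubit and a $k$-qubit register, and of calls to controlled-$U$ and controlled-$U^\dagger$ controlled on one of these qubits. It uses no ancilla qubits and produces no garbage, makes exactly $2^{n-k}\cdot M_{\eta\to\delta_{\mathrm{amp}}}$ calls to controlled-$U$ or controlled-$U^\dagger$, and has the following property. For every unitary $U=\sum_j e^{2\pi i\lambda_j}|\psi_j\rangle\langle\psi_j|$ satisfying the $(n,\alpha)$-rounding promise, the channel implemented by the circuit is within $\delta$ in diamond norm of the channel $\rho\mapsto V\rho V^\dagger$ of some unitary $V$ with $$V\,|0\rangle|\Delta_k(\lambda_j)\rangle|\psi_j\rangle=e^{i\varphi_j}\,|\mathrm{bit}_k(\lambda_j)\rangle|\Delta_k(\lambda_j)\rangle|\psi_j\rangle\quad\text{for all }j$$ for some real phases $\varphi_j$; on the rest of the space $V$ is not constrained. Here the diamond norm of $\Phi$ is $\sup_X\|(\Phi\otimes\mathcal I)(X)\|_1$ over all finite-dimensional reference systems and all operators $X$ with $\|X\|_1\le1$. -/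

import Mathlib

universe u v

noncomputable section

namespace PhaseEst

/-! ### Trace norm, diamond norm, unitary channels -/

/-- Trace norm of a square complex matrix: the sum of its singular values, which are the square
roots of the eigenvalues of `Aᴴ * A`. -/
def traceNorm {ι : Type u} [Fintype ι] [DecidableEq ι] (A : Matrix ι ι ℂ) : ℝ :=
  ∑ i, Real.sqrt ((Matrix.isHermitian_conjTranspose_mul_self A).eigenvalues i)

/-- The action of `Φ ⊗ id` on operators on `ℂ^ι ⊗ ℂ^r`. -/
def ampliation {ι : Type u} (Φ : Matrix ι ι ℂ →ₗ[ℂ] Matrix ι ι ℂ) (r : ℕ)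
    (X : Matrix (ι × Fin r) (ι × Fin r) ℂ) : Matrix (ι × Fin r) (ι × Fin r) ℂ :=
  fun p q => Φ (fun i j => X (i, p.2) (j, q.2)) p.1 q.1

/-- Diamond norm: the supremum of the trace norm of `(Φ ⊗ id) X` over all reference systems and
all operators `X` of trace norm at most one. -/
def diamondNorm {ι : Type u} [Fintype ι] [DecidableEq ι]
    (Φ : Matrix ι ι ℂ →ₗ[ℂ] Matrix ι ι ℂ) : ENNReal :=
  ⨆ (r : ℕ) (X : Matrix (ι × Fin r) (ι × Fin r) ℂ) (_ : traceNorm X ≤ 1),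
    ENNReal.ofReal (traceNorm (ampliation Φ r X))

/-- The channel `ρ ↦ V ρ V†`. -/
def unitaryChannel {ι : Type u} [Fintype ι] (V : Matrix ι ι ℂ) :
    Matrix ι ι ℂ →ₗ[ℂ] Matrix ι ι ℂ where
  toFun ρ := V * ρ * V.conjTranspose
  map_add' ρ σ := by rw [Matrix.mul_add, Matrix.add_mul]
  map_smul' c ρ := by simp

/-! ### Circuits with oracle calls

A circuit acts on `q` workspace qubits, all of them listed, and on a system register `ℂ^S`.
The system register is touched only through the oracle, so that one and the same circuit can be
run with every unitary `U` on every finite-dimensional system. -/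

/-- Elementary operations: a one-qubit or two-qubit unitary on the workspace, or a call to the
oracle `U` or to `U†` controlled on a workspace qubit. -/
inductive Gate (q : ℕ) : Type
  | one (a : Fin q) (G : Matrix.unitaryGroup (Fin 2) ℂ)
  | two (a b : Fin q) (hab : a ≠ b) (G : Matrix.unitaryGroup (Fin 2 × Fin 2) ℂ)
  | ctrlU (a : Fin q)
  | ctrlUDagger (a : Fin q)

/-- A circuit: the list of its operations, the first one to be applied first. -/
abbrev Circuit (q : ℕ) : Type := List (Gate q)

/-- The number of calls to `U` or `U†` made by one operation. -/
def Gate.queries {q : ℕ} : Gate q → ℕ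
  | .one _ _ => 0
  | .two _ _ _ _ => 0
  | .ctrlU _ => 1
  | .ctrlUDagger _ => 1

/-- Query complexity of a circuit. -/
def Circuit.queries {q : ℕ} (C : Circuit q) : ℕ := (C.map Gate.queries).sum

/-- `|1⟩⟨1|_a ⊗ W + |0⟩⟨0|_a ⊗ 1`, identity on the other workspace qubits. -/
def controlled {q : ℕ} {S : Type u} [DecidableEq S] (a : Fin q) (W : Matrix S S ℂ) :
    Matrix ((Fin q → Fin 2) × S) ((Fin q → Fin 2) × S) ℂ :=
  fun x y =>
    if x.1 = y.1 then (if x.1 a = 1 then W x.2 y.2 else (1 : Matrix S S ℂ) x.2 y.2) else 0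

/-- The operator of an operation on `(ℂ²)^{⊗ q} ⊗ ℂ^S`, in the computational basis. -/
def Gate.toMatrix {q : ℕ} {S : Type u} [Fintype S] [DecidableEq S]
    (U : Matrix.unitaryGroup S ℂ) :
    Gate q → Matrix ((Fin q → Fin 2) × S) ((Fin q → Fin 2) × S) ℂ
  | .one a G => fun x y =>
      if x.2 = y.2 ∧ ∀ c, c ≠ a → x.1 c = y.1 c then
        (G : Matrix (Fin 2) (Fin 2) ℂ) (x.1 a) (y.1 a) else 0
  | .two a b _ G => fun x y =>
      if x.2 = y.2 ∧ ∀ c, c ≠ a → c ≠ b → x.1 c = y.1 c then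
        (G : Matrix (Fin 2 × Fin 2) (Fin 2 × Fin 2) ℂ) (x.1 a, x.1 b) (y.1 a, y.1 b) else 0
  | .ctrlU a => controlled a (U : Matrix S S ℂ)
  | .ctrlUDagger a => controlled a (U : Matrix S S ℂ).conjTranspose

/-- The unitary operator implemented by a circuit with oracle `U`. -/
def Circuit.toMatrix {q : ℕ} {S : Type u} [Fintype S] [DecidableEq S]
    (U : Matrix.unitaryGroup S ℂ) :
    Circuit q → Matrix ((Fin q → Fin 2) × S) ((Fin q → Fin 2) × S) ℂ
  | [] => 1
  | g :: C => Circuit.toMatrix U C * g.toMatrix U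

/-! ### The estimation task -/

/-- `U = ∑ⱼ exp(2πi λⱼ) |ψⱼ⟩⟨ψⱼ|`. -/
def IsEigendecomposition {S : Type u} [Fintype S] [DecidableEq S] {J : Type v} [Fintype J]
    (U : Matrix.unitaryGroup S ℂ) (ψ : OrthonormalBasis J ℂ (EuclideanSpace ℂ S))
    (lam : J → ℝ) : Prop :=
  (U : Matrix S S ℂ) =
    ∑ j, Complex.exp (2 * Real.pi * Complex.I * (lam j : ℂ)) •
      Matrix.vecMulVec (fun s => ψ j s) (fun s => star (ψ j s))

/-- The condition that an `(n, α)`-rounding promise puts on the phases: they lie in `[0, 1)` and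
avoid the intervals `[x / 2^n, x / 2^n + α / 2^n]`. -/
def RoundingPromise {J : Type v} (n : ℕ) (α : ℝ) (lam : J → ℝ) : Prop :=
  ∀ j, 0 ≤ lam j ∧ lam j < 1 ∧
    ∀ x : ℕ, x ≤ 2 ^ n → lam j ∉ Set.Icc ((x : ℝ) / 2 ^ n) ((x : ℝ) / 2 ^ n + α / 2 ^ n)

/-- `floor(2^n λ)`. -/
def estimate (n : ℕ) (lam : ℝ) : ℕ := ⌊(2 : ℝ) ^ n * lam⌋₊

/-- The `(k+1)`-th least significant bit of `floor(2^n λ)`. -/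
def bit (n k : ℕ) (lam : ℝ) : Fin 2 := Fin.ofNat 2 (estimate n lam / 2 ^ k)

/-- The number `Δ_k` formed by the `k` least significant bits of `floor(2^n λ)`. -/
def leastBits (n k : ℕ) (lam : ℝ) : ℕ := estimate n lam % 2 ^ k

/-- The `k`-bit binary expansion of a number below `2^k`, most significant bit first. -/
def binary (k x : ℕ) : Fin k → Fin 2 := fun i => Fin.ofNat 2 (x / 2 ^ (k - 1 - (i : ℕ)))

/-- The vector `|b⟩|Δ⟩|ψ⟩`: an output qubit, a `k`-qubit register and the system register. -/
def registerState {k : ℕ} {S : Type u} (b : Fin 2) (x : ℕ) (ψ : EuclideanSpace ℂ S) :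
    (Fin (k + 1) → Fin 2) × S → ℂ :=
  fun p => if p.1 = Fin.cons b (binary k x) then ψ p.2 else 0

/-- The circuit `C` is a correct output, for the parameters `n, α, k, δ`, of a coherent iterative
phase estimator with phases and without garbage. It has no qubits besides the output qubit and the
`k`-qubit register. For every unitary `U` with an `(n, α)`-rounding promise, its channel is
`δ`-close in diamond norm to the channel of some unitary `V` that maps `|0⟩|Δ_k⟩|ψⱼ⟩` to
`exp(iφⱼ) |bit_k(λⱼ)⟩|Δ_k⟩|ψⱼ⟩` for all `j`; on the rest of the space `V` is not constrained. -/
def IsIterativePhaseEstimatorWithPhases (n : ℕ) (α : ℝ) (k : ℕ) (δ : ℝ)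
    (C : Circuit (k + 1)) : Prop :=
  ∀ (S : Type u) [Fintype S] [DecidableEq S] (J : Type v) [Fintype J]
    (U : Matrix.unitaryGroup S ℂ) (ψ : OrthonormalBasis J ℂ (EuclideanSpace ℂ S))
    (lam : J → ℝ), IsEigendecomposition U ψ lam → RoundingPromise n α lam →
    ∃ (V : Matrix.unitaryGroup ((Fin (k + 1) → Fin 2) × S) ℂ) (φ : J → ℝ),
      (∀ j, V.1.mulVec (registerState 0 (leastBits n k (lam j)) (ψ j)) =
        Complex.exp (Complex.I * (φ j : ℂ)) •
          registerState (bit n k (lam j)) (leastBits n k (lam j)) (ψ j)) ∧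
      diamondNorm (unitaryChannel (Circuit.toMatrix U C) - unitaryChannel V.1)
        ≤ ENNReal.ofReal δ

/-! ### The amplifying polynomial -/

/-- Modified Bessel function of the first kind, of order `j`. -/
def besselI (j : ℕ) (t : ℝ) : ℝ :=
  ∑' i : ℕ, (t / 2) ^ (2 * i + j) / ((i.factorial : ℝ) * ((i + j).factorial : ℝ))

/-- The polynomial approximation of the sign function, of degree `2 * N + 1`. -/
def signPoly (κ : ℝ) (N : ℕ) : Polynomial ℝ :=
  Polynomial.C (2 * κ * Real.exp (-(κ ^ 2 / 2)) / Real.sqrt Real.pi) *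
    (Polynomial.C (besselI 0 (κ ^ 2 / 2)) * Polynomial.X +
      ∑ j ∈ Finset.Icc 1 N, Polynomial.C (besselI j (κ ^ 2 / 2) * (-1) ^ j) *
        (Polynomial.C (1 / (2 * (j : ℝ) + 1)) * Polynomial.Chebyshev.T ℝ (2 * (j : ℤ) + 1) -
          Polynomial.C (1 / (2 * (j : ℝ) - 1)) * Polynomial.Chebyshev.T ℝ (2 * (j : ℤ) - 1)))

/-- The steepness parameter of the sign approximation with gap `η` and error `δ`. -/
def steepness (η δ : ℝ) : ℝ :=
  Real.sqrt 2 / (4 * η) * Real.sqrt (Real.log (8 / (Real.pi * δ ^ 2)))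

/-- The polynomial `A_{η→δ}` built with `M`. -/
def ampPoly (η δ : ℝ) (M : ℕ) : Polynomial ℝ :=
  Polynomial.C (1 / 2) - Polynomial.C (1 / 2 / (1 + δ / 2)) *
    (signPoly (steepness η δ) ((M - 1) / 2)).comp (2 * Polynomial.X - 1)

/-- `M` is an admissible value of `M_{η→δ}`: it is odd, `A_{η→δ}` has degree `M`, takes values in
`[0, 1]` on `[0, 1]`, is at least `1 - δ` on `[0, 1/2 - η]` and at most `δ` on `[1/2 + η, 1]`. -/
def IsAmplifyingDegree (η δ : ℝ) (M : ℕ) : Prop :=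
  Odd M ∧ (ampPoly η δ M).natDegree = M ∧
    (∀ x : ℝ, 0 ≤ x → x ≤ 1 → 0 ≤ (ampPoly η δ M).eval x ∧ (ampPoly η δ M).eval x ≤ 1) ∧
    (∀ x : ℝ, 0 ≤ x → x ≤ 1 / 2 - η → 1 - δ ≤ (ampPoly η δ M).eval x) ∧
    (∀ x : ℝ, 1 / 2 + η ≤ x → x ≤ 1 → (ampPoly η δ M).eval x ≤ δ)

/-- The amplification gap `η` for the bit `k`. -/
def ampGap (k : ℕ) (α : ℝ) : ℝ :=
  if k = 0 then α / 2 else 1 / 2 - 1 / 2 ^ k * (1 / 2 + α / 2)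

/-- The amplification error `δ_amp = (1 - 10^{-m}) δ² / 8`. -/
def ampError (m δ : ℝ) : ℝ := (1 - (10 : ℝ) ^ (-m)) * δ ^ 2 / 8

end PhaseEst

end

noncomputable section

namespace PhaseEst

/-! ### Duality between trace norm and operator norm -/

section TraceNorm

open scoped Matrix.Norms.L2Operator InnerProductSpace ComplexOrder

variable {ι : Type u} [Fintype ι] [DecidableEq ι]

/-! Part 2 is quantum signal processing carried out in each eigenspace separately. On the span of
`|0⟩|r⟩|ψⱼ⟩` and `|1⟩|r⟩|ψⱼ⟩`, `N = 2^(n-k-1)` controlled calls followed by phases controlled on the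
register act as `diag (1, e^{iω})`. Write `2^n λⱼ = E + f` with `E` the floor; the promise gives `α
< f < 1`. When `r` holds the `k` low bits of `E`, subtracting their phase and centring `f` leaves `ω
= π ⌊E / 2^k⌋ + y`, with `y` proportional to `f - (1 + α) / 2`. Hence `cos ω = ± cos y`, the sign
being the wanted bit, and `cos y ≥ 2η` (`cos_signalAngle`).

Let `A` be the amplifying polynomial. Both `1 - A²` and `A²` at `(1 + cos ω) / 2` are nonnegative
polynomials in `cos ω` of degree at most `2M`, so by Fejér–Riesz they are squared moduli of
polynomials `P`, `Q` in `e^{iω}` of degree at most `2M` (`hasCircleFactor_of_nonneg`). Any such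
normalized pair is the first column of a product of `2M` signals interleaved with fixed rotations
(`exists_signalProduct_column`); this costs `2M N = 2^(n-k) M` calls. The rotations depend on `A`
only, not on `U`.

The entry of the first column belonging to the correct bit then has modulus at least `1 - δ_amp`, so
the block lies within `√(2 δ_amp) ≤ δ / 2` of a unitary sending `|0⟩` exactly to a phase times that
bit (`exists_near_unitary`). Assembling the blocks preserves operator distance, and the diamond
distance of unitary channels is at most twice it (`diamondNorm_unitaryChannel_sub_le`).

For part 1, `signPoly` is the term-by-term primitive of the Jacobi–Anger (Chebyshev) expansion of
the Gaussian `2κ/√π e^{-κ²x²}`, truncated, and so approximates `erf (κ x)`. The generating function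
of the Bessel functions bounds the tail in Chernoff style (`sum_besselI_le`), and `N` of order `η⁻¹
log δ⁻¹` makes it small enough (`abs_erf_sub_eval_signPoly_le`, `exists_isAmplifyingDegree`). -/

lemma trace_eq_sum_inner_toEuclideanCLM {J : Type*} [Fintype J]
    (b : OrthonormalBasis J ℂ (EuclideanSpace ℂ ι)) (A : Matrix ι ι ℂ) :
    A.trace = ∑ i, ⟪b i, Matrix.toEuclideanCLM (n := ι) (𝕜 := ℂ) A (b i)⟫_ℂ := by
  refine Eq.trans ?_ (LinearMap.trace_eq_sum_inner
    (Matrix.toEuclideanCLM (n := ι) (𝕜 := ℂ) A : EuclideanSpace ℂ ι →ₗ[ℂ] EuclideanSpace ℂ ι) b)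
  rw [Matrix.coe_toEuclideanCLM_eq_toEuclideanLin]
  rw [Matrix.toEuclideanLin_eq_toLin_orthonormal, Matrix.trace_toLin_eq]

/-- The eigenvectors of `Aᴴ * A` have pairwise orthogonal images under `A`, whose norms are the
singular values. -/
lemma inner_apply_eigenvectorBasis (A : Matrix ι ι ℂ) (i j : ι) :
    ⟪Matrix.toEuclideanCLM (n := ι) (𝕜 := ℂ) A
        ((Matrix.isHermitian_conjTranspose_mul_self A).eigenvectorBasis i),
      Matrix.toEuclideanCLM (n := ι) (𝕜 := ℂ) A
        ((Matrix.isHermitian_conjTranspose_mul_self A).eigenvectorBasis j)⟫_ℂ =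
      if i = j then
        ((Matrix.isHermitian_conjTranspose_mul_self A).eigenvalues j : ℂ) else 0 := by
  set H := Matrix.isHermitian_conjTranspose_mul_self A
  rw [← ContinuousLinearMap.adjoint_inner_right, ← ContinuousLinearMap.star_eq_adjoint,
    ← map_star, ← mul_apply_eq_comp, ← map_mul, Matrix.star_eq_conjTranspose]
  have h : Matrix.toEuclideanCLM (n := ι) (𝕜 := ℂ) (A.conjTranspose * A)
      (H.eigenvectorBasis j) = (H.eigenvalues j : ℂ) • H.eigenvectorBasis j := by
    ext s
    have := congrFun (H.mulVec_eigenvectorBasis j) s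
    simpa using this
  rw [h, inner_smul_right, orthonormal_iff_ite.1 H.eigenvectorBasis.orthonormal]
  simp

lemma norm_apply_eigenvectorBasis (A : Matrix ι ι ℂ) (i : ι) :
    ‖Matrix.toEuclideanCLM (n := ι) (𝕜 := ℂ) A
        ((Matrix.isHermitian_conjTranspose_mul_self A).eigenvectorBasis i)‖ =
      Real.sqrt ((Matrix.isHermitian_conjTranspose_mul_self A).eigenvalues i) := by
  have h := inner_apply_eigenvectorBasis A i i
  rw [inner_self_eq_norm_sq_to_K, if_pos rfl] at h
  rw [← Real.sqrt_sq (norm_nonneg _)]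
  congr 1
  exact Complex.ofReal_injective (by simpa using h)

lemma traceNorm_nonneg (A : Matrix ι ι ℂ) : 0 ≤ traceNorm A :=
  Finset.sum_nonneg fun _ _ => Real.sqrt_nonneg _

/-- Computing the trace in the right singular basis of `A` turns it into a sum whose terms are at
most `‖Z‖` times a singular value. -/
lemma norm_trace_mul_le (Z A : Matrix ι ι ℂ) : ‖(Z * A).trace‖ ≤ ‖Z‖ * traceNorm A := by
  set H := Matrix.isHermitian_conjTranspose_mul_self A with hH
  rw [trace_eq_sum_inner_toEuclideanCLM H.eigenvectorBasis, traceNorm, Finset.mul_sum]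
  refine (norm_sum_le _ _).trans (Finset.sum_le_sum fun i _ => ?_)
  refine (norm_inner_le_norm _ _).trans ?_
  rw [H.eigenvectorBasis.orthonormal.1, one_mul, map_mul, mul_apply_eq_comp]
  refine (ContinuousLinearMap.le_opNorm _ _).trans ?_
  rw [norm_apply_eigenvectorBasis, Matrix.l2_opNorm_toEuclideanCLM]

/-- The maximizer is the adjoint of the partial isometry in the polar decomposition of `A`. It makes
the trace norm accessible through traces alone. -/
lemma exists_trace_mul_eq_traceNorm (A : Matrix ι ι ℂ) :
    ∃ Y : Matrix ι ι ℂ, ‖Y‖ ≤ 1 ∧ (Y * A).trace = traceNorm A := by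
  set H := Matrix.isHermitian_conjTranspose_mul_self A with hH
  set T := Matrix.toEuclideanCLM (n := ι) (𝕜 := ℂ) A with hT
  set σ : ι → ℝ := fun i => Real.sqrt (H.eigenvalues i) with hσ
  have hσ2 : ∀ i, σ i * σ i = H.eigenvalues i := fun i =>
    Real.mul_self_sqrt ((Matrix.posSemidef_conjTranspose_mul_self A).eigenvalues_nonneg i)
  -- Left singular vectors. Since `0⁻¹ = 0`, vanishing singular values give the zero vector and drop
  -- out of `Y`; on the others Bessel's inequality yields `‖Y‖ ≤ 1`.
  set f : ι → EuclideanSpace ℂ ι := fun i => ((σ i : ℂ)⁻¹) • T (H.eigenvectorBasis i) with hf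
  have hon : Orthonormal ℂ (fun i : {i // σ i ≠ 0} => f i) := by
    rw [orthonormal_iff_ite]
    rintro ⟨i, hi⟩ ⟨j, hj⟩
    simp only [hf, inner_smul_left, inner_smul_right, Subtype.mk.injEq]
    rw [inner_apply_eigenvectorBasis]
    split_ifs with h
    · subst h
      rw [← hH, ← hσ2 i]
      have : (σ i : ℂ) ≠ 0 := by exact_mod_cast hi
      simp only [map_inv₀, Complex.conj_ofReal, Complex.ofReal_mul]
      field_simp
    · simp
  set Y : EuclideanSpace ℂ ι →L[ℂ] EuclideanSpace ℂ ι :=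
    ∑ i, (innerSL ℂ (f i)).smulRight (H.eigenvectorBasis i) with hY
  have hYx : ∀ x, Y x = ∑ i, ⟪f i, x⟫_ℂ • H.eigenvectorBasis i := fun x => by
    simp [hY]
  refine ⟨(Matrix.toEuclideanCLM (n := ι) (𝕜 := ℂ)).symm Y, ?_, ?_⟩
  · rw [Matrix.cstar_norm_def]
    rw [StarAlgEquiv.apply_symm_apply]
    refine ContinuousLinearMap.opNorm_le_bound _ zero_le_one fun x => ?_
    rw [one_mul, ← sq_le_sq₀ (norm_nonneg _) (norm_nonneg _)]
    have h1 : ‖Y x‖ ^ 2 = ∑ i, ‖⟪f i, x⟫_ℂ‖ ^ 2 := by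
      rw [← H.eigenvectorBasis.sum_sq_norm_inner_right (Y x)]
      refine Finset.sum_congr rfl fun i _ => ?_
      rw [hYx, H.eigenvectorBasis.orthonormal.inner_right_fintype]
    rw [h1]
    have h2 := hon.sum_inner_products_le (s := Finset.univ) x
    refine le_trans (le_of_eq ?_) h2
    rw [← Finset.sum_subtype (Finset.univ.filter fun i => σ i ≠ 0) (by simp)
      (fun i => ‖⟪f i, x⟫_ℂ‖ ^ 2), Finset.sum_filter]
    refine Finset.sum_congr rfl fun i _ => ?_
    split_ifs with h
    · rfl
    · simp [hf, not_not.1 h]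
  · rw [trace_eq_sum_inner_toEuclideanCLM H.eigenvectorBasis, traceNorm, Complex.ofReal_sum]
    refine Finset.sum_congr rfl fun i _ => ?_
    rw [map_mul, StarAlgEquiv.apply_symm_apply, mul_apply_eq_comp, hYx,
      H.eigenvectorBasis.orthonormal.inner_right_fintype]
    simp only [hf, inner_smul_left]
    rw [inner_apply_eigenvectorBasis, if_pos rfl, ← hH, ← hσ2 i]
    rcases eq_or_ne (σ i) 0 with h | h
    · simp [h]
    · have : (σ i : ℂ) ≠ 0 := by exact_mod_cast h
      simp only [map_inv₀, Complex.conj_ofReal, Complex.ofReal_mul]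
      field_simp
      simp [hσ]

/-- Block diagonal matrices with equal square blocks, as a homomorphism of C⋆-algebras. -/
def blockDiagonalStarAlgHom (m o : Type*) [Fintype m] [DecidableEq m] [Fintype o]
    [DecidableEq o] : (o → Matrix m m ℂ) →⋆ₐ[ℂ] Matrix (m × o) (m × o) ℂ where
  toFun := Matrix.blockDiagonal
  map_one' := Matrix.blockDiagonal_one
  map_mul' := Matrix.blockDiagonal_mul
  map_zero' := Matrix.blockDiagonal_zero
  map_add' := Matrix.blockDiagonal_add
  commutes' c := by
    rw [Algebra.algebraMap_eq_smul_one, Matrix.blockDiagonal_smul, Matrix.blockDiagonal_one,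
      Algebra.algebraMap_eq_smul_one]
  map_star' A := (Matrix.blockDiagonal_conjTranspose A).symm

/-- Homomorphisms of C⋆-algebras are contractive. This serves both for reference systems (`V ⊗ 1`)
and for blocks in the eigenbasis. -/
lemma norm_blockDiagonal_le {m o : Type*} [Fintype m] [DecidableEq m] [Fintype o]
    [DecidableEq o] (A : o → Matrix m m ℂ) {c : ℝ} (hc : 0 ≤ c) (h : ∀ i, ‖A i‖ ≤ c) :
    ‖Matrix.blockDiagonal A‖ ≤ c :=
  (NonUnitalStarAlgHom.norm_apply_le (blockDiagonalStarAlgHom m o) A).trans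
    ((pi_norm_le_iff_of_nonneg hc).2 h)

lemma ampliation_unitaryChannel {ι : Type u} [Fintype ι] (V : Matrix ι ι ℂ) (r : ℕ)
    (X : Matrix (ι × Fin r) (ι × Fin r) ℂ) :
    ampliation (unitaryChannel V) r X = Matrix.blockDiagonal (fun _ : Fin r => V) * X *
      (Matrix.blockDiagonal (fun _ : Fin r => V)).conjTranspose := by
  ext ⟨i, a⟩ ⟨j, b⟩
  simp [ampliation, unitaryChannel, Matrix.mul_apply, Matrix.blockDiagonal_apply,
    Fintype.sum_prod_type, Matrix.conjTranspose_apply, Finset.sum_mul, apply_ite]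
  exact Finset.sum_congr rfl fun y _ => Finset.sum_mul _ _ _

/-- By duality and cyclicity of the trace it suffices to bound `W†YW - V†YV`, which telescopes into
two terms each containing `W - V` once. -/
lemma traceNorm_conj_sub_conj_le (W V X : Matrix ι ι ℂ) (hW : ‖W‖ ≤ 1) (hV : ‖V‖ ≤ 1) :
    traceNorm (W * X * W.conjTranspose - V * X * V.conjTranspose) ≤
      2 * ‖W - V‖ * traceNorm X := by
  obtain ⟨Y, hY, h⟩ := exists_trace_mul_eq_traceNorm
    (W * X * W.conjTranspose - V * X * V.conjTranspose)
  have key : (Y * (W * X * W.conjTranspose - V * X * V.conjTranspose)).trace =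
      (((W - V).conjTranspose * Y * W + V.conjTranspose * Y * (W - V)) * X).trace := by
    have h1 : ∀ Z : Matrix ι ι ℂ, (Y * (Z * X * Z.conjTranspose)).trace =
        (Z.conjTranspose * Y * Z * X).trace := fun Z => by
      rw [Matrix.trace_mul_comm, Matrix.mul_assoc, Matrix.trace_mul_comm]
      simp only [Matrix.mul_assoc]
    rw [Matrix.mul_sub, Matrix.trace_sub, h1, h1, ← Matrix.trace_sub]
    congr 1
    rw [Matrix.conjTranspose_sub]
    noncomm_ring
  rw [← abs_of_nonneg (traceNorm_nonneg (W * X * W.conjTranspose - V * X * V.conjTranspose)),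
    ← Real.norm_eq_abs, ← Complex.norm_real, ← h, key]
  refine (norm_trace_mul_le _ _).trans (mul_le_mul_of_nonneg_right ?_ (traceNorm_nonneg X))
  refine (norm_add_le _ _).trans ?_
  have h2 : ‖(W - V).conjTranspose * Y * W‖ ≤ ‖W - V‖ * 1 * 1 := by
    refine (norm_mul_le _ _).trans (mul_le_mul ?_ hW (norm_nonneg _) (by positivity))
    refine (norm_mul_le _ _).trans ?_
    rw [Matrix.l2_opNorm_conjTranspose]
    gcongr
  have h3 : ‖V.conjTranspose * Y * (W - V)‖ ≤ 1 * 1 * ‖W - V‖ := by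
    refine (norm_mul_le _ _).trans (mul_le_mul_of_nonneg_right ?_ (norm_nonneg _))
    refine (norm_mul_le _ _).trans ?_
    rw [Matrix.l2_opNorm_conjTranspose]
    gcongr
  linarith

/-- Channels of operators that are close in operator norm are close in diamond norm. -/
lemma diamondNorm_unitaryChannel_sub_le (W V : Matrix ι ι ℂ) (hW : ‖W‖ ≤ 1) (hV : ‖V‖ ≤ 1) :
    diamondNorm (unitaryChannel W - unitaryChannel V) ≤ ENNReal.ofReal (2 * ‖W - V‖) := by
  refine iSup_le fun r => iSup_le fun X => iSup_le fun hX => ENNReal.ofReal_le_ofReal ?_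
  have h1 : ampliation (unitaryChannel W - unitaryChannel V) r X =
      ampliation (unitaryChannel W) r X - ampliation (unitaryChannel V) r X := rfl
  rw [h1, ampliation_unitaryChannel, ampliation_unitaryChannel]
  refine (traceNorm_conj_sub_conj_le _ _ X (norm_blockDiagonal_le _ zero_le_one fun _ => hW)
    (norm_blockDiagonal_le _ zero_le_one fun _ => hV)).trans ?_
  rw [← Matrix.blockDiagonal_sub]
  have h2 : ‖Matrix.blockDiagonal ((fun _ : Fin r => W) - fun _ => V)‖ ≤ ‖W - V‖ :=
    norm_blockDiagonal_le _ (norm_nonneg (W - V)) (fun _ => le_rfl)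
  nlinarith [norm_nonneg (W - V), traceNorm_nonneg X]

end TraceNorm

/-! ### Fejér–Riesz factorization of polynomials in `cos θ` -/

section FejerRiesz

open Polynomial Filter Topology

lemma eval_nonneg_of_forall_Ioc {q : ℝ[X]} {c : ℝ} (hc : c < 1)
    (h : ∀ x, c < x → x ≤ 1 → 0 ≤ q.eval x) : 0 ≤ q.eval c := by
  refine ge_of_tendsto (x := 𝓝[>] c) ((q.continuous.tendsto c).mono_left nhdsWithin_le_nhds) ?_
  filter_upwards [Ioc_mem_nhdsGT hc] with x hx using h x hx.1 hx.2

lemma eval_nonneg_of_forall_Ico {q : ℝ[X]} {c : ℝ} (hc : -1 < c)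
    (h : ∀ x, -1 ≤ x → x < c → 0 ≤ q.eval x) : 0 ≤ q.eval c := by
  refine ge_of_tendsto (x := 𝓝[<] c) ((q.continuous.tendsto c).mono_left nhdsWithin_le_nhds) ?_
  filter_upwards [Ico_mem_nhdsLT hc] with x hx using h x hx.1 hx.2

/-- On the unit circle, `p (Re z) = |Q z|²` for some `Q` of degree at most `d`. -/
def HasCircleFactor (p : ℝ[X]) (d : ℕ) : Prop :=
  ∃ Q : ℂ[X], Q.natDegree ≤ d ∧ ∀ z : ℂ, ‖z‖ = 1 → ‖Q.eval z‖ ^ 2 = p.eval z.re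

lemma HasCircleFactor.mul {p q : ℝ[X]} {d e : ℕ} (hp : HasCircleFactor p d)
    (hq : HasCircleFactor q e) : HasCircleFactor (p * q) (d + e) := by
  obtain ⟨P, hP, hP'⟩ := hp
  obtain ⟨Q, hQ, hQ'⟩ := hq
  refine ⟨P * Q, natDegree_mul_le.trans (add_le_add hP hQ), fun z hz => ?_⟩
  rw [eval_mul, norm_mul, mul_pow, hP' z hz, hQ' z hz, eval_mul]

lemma HasCircleFactor.mono {p : ℝ[X]} {d e : ℕ} (hp : HasCircleFactor p d) (h : d ≤ e) :
    HasCircleFactor p e := by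
  obtain ⟨P, hP, hP'⟩ := hp
  exact ⟨P, hP.trans h, hP'⟩

lemma hasCircleFactor_C {a : ℝ} (ha : 0 ≤ a) : HasCircleFactor (C a) 0 := by
  refine ⟨C (Real.sqrt a : ℂ), by simp, fun z _ => ?_⟩
  simp [Real.sq_sqrt ha]

lemma norm_sq_add_mul_of_norm_eq_one (a b : ℝ) {z : ℂ} (hz : ‖z‖ = 1) :
    ‖(a : ℂ) + b * z‖ ^ 2 = a ^ 2 + b ^ 2 + 2 * a * b * z.re := by
  have h : z.re * z.re + z.im * z.im = 1 := by
    rw [← Complex.normSq_apply, Complex.normSq_eq_norm_sq, hz, one_pow]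
  rw [← Complex.normSq_eq_norm_sq, Complex.normSq_apply]
  simp
  linear_combination b ^ 2 * h

/-- The factor `a + b z` must satisfy `a² + b² = c` and `2ab = s`; solving gives the half sum and
half difference of `√(c + 1)` and `√(c - 1)`. -/
lemma hasCircleFactor_linear {c s : ℝ} (hc : 1 ≤ c) (hs : s ^ 2 = 1) :
    HasCircleFactor (C c + C s * X) 1 := by
  have h1 := Real.sq_sqrt (show 0 ≤ c + 1 by linarith)
  have h2 := Real.sq_sqrt (show 0 ≤ c - 1 by linarith)
  set x := Real.sqrt (c + 1)
  set y := Real.sqrt (c - 1)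
  refine ⟨C (((x + y) / 2 : ℝ) : ℂ) + C ((s * ((x - y) / 2) : ℝ) : ℂ) * X,
    by compute_degree, fun z hz => ?_⟩
  rw [eval_add, eval_mul, eval_C, eval_C, eval_X, norm_sq_add_mul_of_norm_eq_one _ _ hz]
  simp only [eval_add, eval_mul, eval_C, eval_X]
  linear_combination (1 / 2 + s * z.re / 2) * h1 + (1 / 2 - s * z.re / 2) * h2 +
    (x - y) ^ 2 / 4 * hs

/-- On the circle `Re z = (z + z⁻¹) / 2`, so `z (Re z - c)` is a polynomial in `z`, of modulus `|Re
z - c|`. Real `c` covers double roots, nonreal `c` conjugate pairs. -/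
lemma hasCircleFactor_quadratic (c : ℂ) :
    HasCircleFactor (X ^ 2 - C (2 * c.re) * X + C (‖c‖ ^ 2)) 2 := by
  refine ⟨C (1 / 2) * X ^ 2 - C c * X + C (1 / 2), by compute_degree, fun z hz => ?_⟩
  have h : z.re * z.re + z.im * z.im = 1 := by
    rw [← Complex.normSq_apply, Complex.normSq_eq_norm_sq, hz, one_pow]
  have h1 : (C (1 / 2) * X ^ 2 - C c * X + C (1 / 2) : ℂ[X]).eval z = z * ((z.re : ℂ) - c) := by
    simp only [eval_add, eval_sub, eval_mul, eval_C, eval_X, eval_pow]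
    apply Complex.ext
    · simp [pow_two]
      linear_combination (-1 / 2) * h
    · simp [pow_two]
      ring
  rw [h1, norm_mul, hz, one_mul, ← Complex.normSq_eq_norm_sq, ← Complex.normSq_eq_norm_sq,
    Complex.normSq_apply, Complex.normSq_apply]
  simp
  ring

lemma exists_eq_X_sub_C_mul {p : ℝ[X]} (hp : p ≠ 0) {c : ℝ} (h : p.eval c = 0) :
    ∃ q : ℝ[X], p = (X - C c) * q ∧ q ≠ 0 ∧ p.natDegree = q.natDegree + 1 := by
  obtain ⟨q, rfl⟩ := dvd_iff_isRoot.2 h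
  have hq : q ≠ 0 := right_ne_zero_of_mul hp
  refine ⟨q, rfl, hq, ?_⟩
  rw [natDegree_mul (X_sub_C_ne_zero c) hq, natDegree_X_sub_C, add_comm]

/-- Strong induction, splitting off a complex root. A real root outside `(-1, 1)` gives a linear
factor nonnegative on the interval, a real root inside is at least double, and a nonreal root comes
with its conjugate. Each cofactor is again nonnegative on `[-1, 1]`, by continuity at the removed
root where needed. -/
theorem hasCircleFactor_of_nonneg (d : ℕ) : ∀ p : ℝ[X], p.natDegree = d →
    (∀ x, -1 ≤ x → x ≤ 1 → 0 ≤ p.eval x) → HasCircleFactor p d := by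
  induction d using Nat.strong_induction_on with
  | _ d ih =>
  intro p hd hp
  rcases Nat.eq_zero_or_pos d with h0 | hpos
  · subst h0
    obtain ⟨a, rfl⟩ := natDegree_eq_zero.1 hd
    exact hasCircleFactor_C (by simpa using hp 0 (by norm_num) (by norm_num))
  have hp0 : p ≠ 0 := by rintro rfl; simp at hd; omega
  obtain ⟨w, hw⟩ := IsAlgClosed.exists_aeval_eq_zero ℂ p (by
    rw [degree_eq_natDegree hp0, hd]; exact_mod_cast hpos.ne')
  by_cases him : w.im = 0
  · obtain ⟨c, rfl⟩ : ∃ c : ℝ, w = c := ⟨w.re, Complex.ext rfl (by simpa using him)⟩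
    have hc : p.eval c = 0 := by
      have := aeval_algebraMap_apply_eq_algebraMap_eval (A := ℂ) c p
      simp only [Complex.coe_algebraMap] at this
      rw [hw] at this
      exact_mod_cast this.symm
    obtain ⟨q, hpq, hq0, hdq⟩ := exists_eq_X_sub_C_mul hp0 hc
    have hev : ∀ x, p.eval x = (x - c) * q.eval x := fun x => by rw [hpq]; simp
    rcases le_or_gt 1 c with h1 | h1
    · have hq : ∀ x, -1 ≤ x → x < 1 → 0 ≤ (-q).eval x := fun x hx hx' => by
        have := hp x hx hx'.le
        rw [hev] at this
        rw [eval_neg]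
        nlinarith
      have h2 := ih (d - 1) (by omega) (-q) (by rw [natDegree_neg]; omega) fun x hx hx' => by
        rcases hx'.lt_or_eq with h | rfl
        · exact hq x hx h
        · exact eval_nonneg_of_forall_Ico (by norm_num) hq
      have h3 := (hasCircleFactor_linear h1 (s := -1) (by norm_num)).mul h2
      have h4 : (C c + C (-1) * X) * -q = p := by rw [hpq, C_neg, C_1]; ring
      rw [h4] at h3
      exact h3.mono (by omega)
    rcases le_or_gt c (-1) with h1' | h1'
    · have hq : ∀ x, -1 < x → x ≤ 1 → 0 ≤ q.eval x := fun x hx hx' => by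
        have := hp x hx.le hx'
        rw [hev] at this
        nlinarith
      have h2 := ih (d - 1) (by omega) q (by omega) fun x hx hx' => by
        rcases hx.lt_or_eq with h | rfl
        · exact hq x h hx'
        · exact eval_nonneg_of_forall_Ioc (by norm_num) hq
      have h3 := (hasCircleFactor_linear (c := -c) (by linarith) (s := 1) (by norm_num)).mul h2
      have h4 : (C (-c) + C 1 * X) * q = p := by rw [hpq, C_neg, C_1]; ring
      rw [h4] at h3
      exact h3.mono (by omega)
    · have hr : ∀ x, c < x → x ≤ 1 → 0 ≤ q.eval x := fun x hx hx' => by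
        have := hp x (by linarith) hx'
        rw [hev] at this
        nlinarith
      have hl : ∀ x, -1 ≤ x → x < c → 0 ≤ (-q).eval x := fun x hx hx' => by
        have := hp x hx (by linarith)
        rw [hev] at this
        rw [eval_neg]
        nlinarith
      -- As `p ≥ 0` on both sides of `c`, the cofactor changes sign there and vanishes: the root is
      -- at least double.
      have hqc : q.eval c = 0 := by
        have h2 := eval_nonneg_of_forall_Ico h1' hl
        rw [eval_neg] at h2
        linarith [eval_nonneg_of_forall_Ioc h1 hr]
      obtain ⟨r, hqr, hr0, hdr⟩ := exists_eq_X_sub_C_mul hq0 hqc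
      have hevr : ∀ x, q.eval x = (x - c) * r.eval x := fun x => by rw [hqr]; simp
      have hrr : ∀ x, c < x → x ≤ 1 → 0 ≤ r.eval x := fun x hx hx' => by
        have := hr x hx hx'
        rw [hevr] at this
        nlinarith
      have hrl : ∀ x, -1 ≤ x → x < c → 0 ≤ r.eval x := fun x hx hx' => by
        have := hl x hx hx'
        rw [eval_neg, hevr] at this
        nlinarith
      have h2 := ih (d - 2) (by omega) r (by omega) fun x hx hx' => by
        rcases lt_trichotomy x c with h | rfl | h
        · exact hrl x hx h
        · exact eval_nonneg_of_forall_Ioc h1 hrr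
        · exact hrr x h hx'
      have h3 := (hasCircleFactor_quadratic (c : ℂ)).mul h2
      have h4 : (X ^ 2 - C (2 * (c : ℂ).re) * X + C (‖(c : ℂ)‖ ^ 2)) * r = p := by
        rw [hpq, hqr]
        simp only [Complex.ofReal_re, Complex.norm_real, Real.norm_eq_abs, sq_abs, C_mul, C_pow,
          C_ofNat]
        ring
      rw [h4] at h3
      exact h3.mono (by omega)
  · obtain ⟨q, hpq⟩ := quadratic_dvd_of_aeval_eq_zero_im_ne_zero p hw him
    have hq0 : q ≠ 0 := by rintro rfl; exact hp0 (by simpa using hpq)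
    have hm : (X ^ 2 - C (2 * w.re) * X + C (‖w‖ ^ 2)).natDegree = 2 := by compute_degree!
    have hdq : p.natDegree = 2 + q.natDegree := by
      rw [hpq, natDegree_mul _ hq0, hm]
      intro h
      rw [h] at hm
      simp at hm
    have h2 := ih (d - 2) (by omega) q (by omega) fun x hx hx' => by
      have h3 := hp x hx hx'
      rw [hpq, eval_mul] at h3
      refine nonneg_of_mul_nonneg_right h3 ?_
      simp only [eval_add, eval_sub, eval_mul, eval_pow, eval_X, eval_C]
      have h4 : ‖w‖ ^ 2 = w.re ^ 2 + w.im ^ 2 := by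
        rw [← Complex.normSq_eq_norm_sq, Complex.normSq_apply]; ring
      have h5 : 0 < w.im ^ 2 := by positivity
      rw [h4]
      nlinarith [sq_nonneg (x - w.re)]
    have h3 := (hasCircleFactor_quadratic w).mul h2
    rw [← hpq] at h3
    exact h3.mono (by omega)

end FejerRiesz

/-! ### Quantum signal processing -/

section SignalProcessing

open Polynomial
open scoped ComplexConjugate

lemma infinite_setOf_norm_eq_one : {z : ℂ | ‖z‖ = 1}.Infinite := by
  have h : (Metric.sphere (0 : ℂ) 1).Infinite :=
    (isPreconnected_sphere (by simp [Complex.rank_real_complex]) 0 1).infinite_of_nontrivial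
      ⟨1, by simp, -1, by simp, by norm_num⟩
  refine h.mono fun z hz => by simpa using hz

/-- Since `conj z = z⁻¹` on the circle, conjugation of values becomes reversal of conjugated
coefficients, up to `z ^ d`; identities on the circle thereby become polynomial identities. -/
lemma eval_reflect_map_conj {d : ℕ} {P : ℂ[X]} (hP : P.natDegree ≤ d) {z : ℂ} (hz : ‖z‖ = 1) :
    (reflect d (P.map (starRingEnd ℂ))).eval z = z ^ d * conj (P.eval z) := by
  have hzz : z * conj z = 1 := by
    rw [Complex.mul_conj, Complex.normSq_eq_norm_sq, hz]; simp
  let _ : Invertible (conj z) := ⟨z, hzz, by rw [mul_comm]; exact hzz⟩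
  have h := eval₂_reflect_mul_pow (RingHom.id ℂ) (conj z) d (P.map (starRingEnd ℂ))
    (natDegree_map_le.trans hP)
  have h2 : ⅟(conj z) = z := rfl
  rw [h2, eval₂_id, eval₂_id, eval_map_apply] at h
  rw [← h, mul_left_comm, ← mul_pow, hzz, one_pow, mul_one]

/-- The extreme coefficients of a pair of polynomials that is normalized on the unit circle are
orthogonal. -/
lemma coeff_orthogonal {d : ℕ} (hd : 0 < d) {P Q : ℂ[X]} (hP : P.natDegree ≤ d)
    (hQ : Q.natDegree ≤ d)
    (h : ∀ z : ℂ, ‖z‖ = 1 → ‖P.eval z‖ ^ 2 + ‖Q.eval z‖ ^ 2 = 1) :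
    P.coeff d * conj (P.coeff 0) + Q.coeff d * conj (Q.coeff 0) = 0 := by
  set P' := reflect d (P.map (starRingEnd ℂ)) with hP'
  set Q' := reflect d (Q.map (starRingEnd ℂ)) with hQ'
  have h0 : P * P' + Q * Q' - X ^ d = 0 := by
    refine eq_zero_of_infinite_isRoot _ (infinite_setOf_norm_eq_one.mono fun z hz => ?_)
    have hz : ‖z‖ = 1 := hz
    simp only [Set.mem_ofPred_eq, IsRoot.def, eval_sub, eval_add, eval_mul, eval_pow, eval_X]
    rw [hP', hQ', eval_reflect_map_conj hP hz, eval_reflect_map_conj hQ hz]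
    have h1 : P.eval z * conj (P.eval z) + Q.eval z * conj (Q.eval z) = 1 := by
      rw [Complex.mul_conj, Complex.mul_conj, Complex.normSq_eq_norm_sq,
        Complex.normSq_eq_norm_sq]
      exact_mod_cast h z hz
    linear_combination z ^ d * h1
  have hdeg : ∀ {R : ℂ[X]}, R.natDegree ≤ d →
      (reflect d (R.map (starRingEnd ℂ))).natDegree ≤ d := fun {R} hR =>
    (natDegree_reflect_le).trans (max_le le_rfl (natDegree_map_le.trans hR))
  have hc : ∀ R : ℂ[X], (reflect d (R.map (starRingEnd ℂ))).coeff d = conj (R.coeff 0) :=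
    fun R => by rw [coeff_reflect, revAt_le le_rfl, Nat.sub_self, coeff_map]
  -- In the top degree `2d` the monomial `X ^ d` does not contribute, because `d > 0`.
  have h2 := congrArg (fun p => coeff p (d + d)) h0
  simp only [coeff_sub, coeff_add, coeff_zero, coeff_X_pow] at h2
  rw [coeff_mul_add_eq_of_natDegree_le hP (hdeg hP), coeff_mul_add_eq_of_natDegree_le hQ (hdeg hQ), hc, hc,
    if_neg (by omega), sub_zero] at h2
  exact h2

/-- Take `(a, b)` along `(p, q)`, which `h` makes orthogonal to `(r, s)`. If `(p, q) = 0`, any unit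
vector orthogonal to `(r, s)` serves. -/
lemma exists_adapted_unit_vector {p q r s : ℂ} (h : r * conj p + s * conj q = 0) :
    ∃ a b : ℂ, a * conj a + b * conj b = 1 ∧ a * q - b * p = 0 ∧ conj a * r + conj b * s = 0 := by
  have hnorm : ∀ x y : ℂ, (x ≠ 0 ∨ y ≠ 0) → ∃ c : ℝ, (c * c) * (x * conj x + y * conj y) = 1 := by
    intro x y hxy
    have hpos : 0 < Complex.normSq x + Complex.normSq y := by
      rcases hxy with hx | hy
      · exact add_pos_of_pos_of_nonneg (Complex.normSq_pos.2 hx) (Complex.normSq_nonneg y)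
      · exact add_pos_of_nonneg_of_pos (Complex.normSq_nonneg x) (Complex.normSq_pos.2 hy)
    refine ⟨(Real.sqrt (Complex.normSq x + Complex.normSq y))⁻¹, ?_⟩
    rw [Complex.mul_conj, Complex.mul_conj]
    norm_cast
    rw [← mul_inv, Real.mul_self_sqrt hpos.le, inv_mul_cancel₀ hpos.ne']
  by_cases hpq : p ≠ 0 ∨ q ≠ 0
  · obtain ⟨c, hc⟩ := hnorm p q hpq
    refine ⟨c * p, c * q, ?_, by ring, ?_⟩
    · simp only [map_mul, Complex.conj_ofReal]
      linear_combination hc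
    · simp only [map_mul, Complex.conj_ofReal]
      linear_combination (c : ℂ) * h
  · push Not at hpq
    obtain ⟨rfl, rfl⟩ := hpq
    by_cases hrs : r ≠ 0 ∨ s ≠ 0
    · obtain ⟨c, hc⟩ := hnorm r s hrs
      refine ⟨c * conj s, -(c * conj r), ?_, by ring, ?_⟩
      · simp only [map_mul, map_neg, Complex.conj_ofReal, Complex.conj_conj]
        linear_combination hc
      · simp only [map_mul, map_neg, Complex.conj_ofReal, Complex.conj_conj]
        ring
    · push Not at hrs
      exact ⟨1, 0, by simp, by simp, by simp [hrs.1]⟩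

/-- The special unitary with first column `(a, b)`. -/
def completion (a b : ℂ) (h : a * conj a + b * conj b = 1) : Matrix.unitaryGroup (Fin 2) ℂ :=
  ⟨!![a, -conj b; b, conj a], by
    rw [Matrix.mem_unitaryGroup_iff]
    ext i j
    fin_cases i <;> fin_cases j <;>
      simp [Matrix.mul_apply, Fin.sum_univ_two, Matrix.star_apply]
    · linear_combination h
    · ring
    · ring
    · linear_combination h⟩

/-- The alternating product of the rotations in a list with the signal operator
`diag (1, z)`. -/
def signalProduct (z : ℂ) (G : Matrix.unitaryGroup (Fin 2) ℂ) :
    List (Matrix.unitaryGroup (Fin 2) ℂ) → Matrix (Fin 2) (Fin 2) ℂ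
  | [] => G.1
  | H :: L => H.1 * Matrix.diagonal ![1, z] * signalProduct z G L

lemma diagonal_mem_unitaryGroup {z : ℂ} (hz : ‖z‖ = 1) :
    Matrix.diagonal ![1, z] ∈ Matrix.unitaryGroup (Fin 2) ℂ := by
  have hzz : z * conj z = 1 := by
    rw [Complex.mul_conj, Complex.normSq_eq_norm_sq, hz]; simp
  rw [Matrix.mem_unitaryGroup_iff]
  ext i j
  fin_cases i <;> fin_cases j <;>
    simp [Matrix.mul_apply, Fin.sum_univ_two, Matrix.star_apply, hzz]

lemma signalProduct_mem_unitaryGroup {z : ℂ} (hz : ‖z‖ = 1)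
    (G : Matrix.unitaryGroup (Fin 2) ℂ) (L : List (Matrix.unitaryGroup (Fin 2) ℂ)) :
    signalProduct z G L ∈ Matrix.unitaryGroup (Fin 2) ℂ := by
  induction L with
  | nil => exact G.2
  | cons H L ih => exact mul_mem (mul_mem H.2 (diagonal_mem_unitaryGroup hz)) ih

/-- Peel off one rotation at a time. The constant and the top coefficient vectors of `(P, Q)` are
orthogonal, so one rotation can at once remove the top coefficient of the first component and the
constant term of the second. Dividing the second component by `z` undoes one signal and leaves a
normalized pair of degree at most `d`. -/
theorem exists_signalProduct_column (d : ℕ) : ∀ P Q : ℂ[X], P.natDegree ≤ d → Q.natDegree ≤ d →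
    (∀ z : ℂ, ‖z‖ = 1 → ‖P.eval z‖ ^ 2 + ‖Q.eval z‖ ^ 2 = 1) →
    ∃ (G : Matrix.unitaryGroup (Fin 2) ℂ) (L : List (Matrix.unitaryGroup (Fin 2) ℂ)),
      L.length = d ∧ ∀ z : ℂ, ‖z‖ = 1 →
        signalProduct z G L 0 0 = P.eval z ∧ signalProduct z G L 1 0 = Q.eval z := by
  induction d with
  | zero =>
    intro P Q hP hQ h
    obtain ⟨a, rfl⟩ := natDegree_eq_zero.1 (Nat.le_zero.1 hP)
    obtain ⟨b, rfl⟩ := natDegree_eq_zero.1 (Nat.le_zero.1 hQ)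
    have hab : a * conj a + b * conj b = 1 := by
      rw [Complex.mul_conj, Complex.mul_conj, Complex.normSq_eq_norm_sq,
        Complex.normSq_eq_norm_sq]
      exact_mod_cast (by simpa using h 1 (by simp))
    exact ⟨completion a b hab, [], rfl, fun z _ => by simp [signalProduct, completion]⟩
  | succ d ih =>
    intro P Q hP hQ h
    obtain ⟨a, b, hab, hlow, hhigh⟩ := exists_adapted_unit_vector
      (coeff_orthogonal d.succ_pos hP hQ h)
    set P' : ℂ[X] := C (conj a) * P + C (conj b) * Q with hP'
    set R : ℂ[X] := C a * Q - C b * P with hR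
    have hRX : X * R.divX = R := by
      conv_rhs => rw [← X_mul_divX_add R]
      rw [hR]
      simp [hlow]
    have hP'd : P'.natDegree ≤ d := by
      have h1 : P'.natDegree ≤ d + 1 := by
        refine (natDegree_add_le _ _).trans (max_le ?_ ?_)
        · exact (natDegree_C_mul_le _ _).trans hP
        · exact (natDegree_C_mul_le _ _).trans hQ
      refine Nat.lt_succ_iff.1 (lt_of_le_of_ne h1 fun h2 => ?_)
      have h3 : P'.coeff (d + 1) = 0 := by simpa [hP'] using hhigh
      change P'.natDegree = d + 1 at h2
      rw [← h2, coeff_natDegree, leadingCoeff_eq_zero] at h3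
      rw [h3] at h2
      simp at h2
    have hQ'd : R.divX.natDegree ≤ d := by
      rw [natDegree_divX_eq_natDegree_tsub_one]
      have h1 : R.natDegree ≤ d + 1 := by
        refine (natDegree_sub_le _ _).trans (max_le ?_ ?_)
        · exact (natDegree_C_mul_le _ _).trans hQ
        · exact (natDegree_C_mul_le _ _).trans hP
      omega
    have hRz : ∀ z : ℂ, z * R.divX.eval z = a * Q.eval z - b * P.eval z := fun z => by
      have := congrArg (eval z) hRX
      simpa [hR] using this
    have hPz : ∀ z : ℂ, P'.eval z = conj a * P.eval z + conj b * Q.eval z := fun z => by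
      simp [hP']
    have hnorm : ∀ z : ℂ, ‖z‖ = 1 → ‖P'.eval z‖ ^ 2 + ‖R.divX.eval z‖ ^ 2 = 1 := by
      intro z hz
      rw [← h z hz]
      have h1 : ‖R.divX.eval z‖ = ‖z * R.divX.eval z‖ := by rw [norm_mul, hz, one_mul]
      rw [h1, hRz, hPz]
      apply Complex.ofReal_injective
      simp only [← Complex.normSq_eq_norm_sq, Complex.ofReal_add, ← Complex.mul_conj, map_add,
        map_sub, map_mul, Complex.conj_conj]
      linear_combination (P.eval z * conj (P.eval z) + Q.eval z * conj (Q.eval z)) * hab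
    obtain ⟨G, L, hL, hGL⟩ := ih P' R.divX hP'd hQ'd hnorm
    refine ⟨G, completion a b hab :: L, by simp [hL], fun z hz => ?_⟩
    obtain ⟨h1, h2⟩ := hGL z hz
    have h3 := hRz z
    have h4 := hPz z
    constructor
    · simp [signalProduct, completion, Matrix.mul_apply, Fin.sum_univ_two, h1, h2, h4,
        Matrix.vecMul_diagonal]
      linear_combination P.eval z * hab - conj b * h3
    · simp [signalProduct, completion, Matrix.mul_apply, Fin.sum_univ_two, h1, h2, h4,
        Matrix.vecMul_diagonal]
      linear_combination Q.eval z * hab + conj a * h3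

end SignalProcessing

/-! ### Circuits in the eigenbasis of the oracle -/

section Blocks

open scoped ComplexConjugate

variable {k : ℕ} {S : Type u} [Fintype S] {J : Type v} [Fintype J]

/-- The matrix whose columns are the vectors `|b⟩|r⟩|ψⱼ⟩`. -/
def eigenFrame (k : ℕ) (ψ : OrthonormalBasis J ℂ (EuclideanSpace ℂ S)) :
    Matrix ((Fin (k + 1) → Fin 2) × S) (Fin 2 × ((Fin k → Fin 2) × J)) ℂ :=
  fun p q => if p.1 = Fin.cons q.1 q.2.1 then ψ q.2.2 p.2 else 0

variable (ψ : OrthonormalBasis J ℂ (EuclideanSpace ℂ S))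

lemma mul_eigenFrame_apply {ι : Type*} (A : Matrix ι ((Fin (k + 1) → Fin 2) × S) ℂ) (i : ι)
    (b : Fin 2) (r : Fin k → Fin 2) (j : J) :
    (A * eigenFrame k ψ) i (b, (r, j)) =
      ∑ t, A i ((Fin.cons b r : Fin (k + 1) → Fin 2), t) * ψ j t := by
  simp [Matrix.mul_apply, eigenFrame, Fintype.sum_prod_type]

lemma eigenFrame_apply_cons (a b : Fin 2) (y r : Fin k → Fin 2) (s : S) (j : J) :
    eigenFrame k ψ ((Fin.cons a y : Fin (k + 1) → Fin 2), s) (b, (r, j)) =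
      if a = b ∧ y = r then ψ j s else 0 := by
  simp [eigenFrame, Fin.cons_inj]

lemma sum_star_mul_eq_ite [DecidableEq J] (i j : J) :
    ∑ t, star (ψ i t) * ψ j t = if i = j then 1 else 0 := by
  rw [← orthonormal_iff_ite.1 ψ.orthonormal i j, PiLp.inner_apply]
  simp [mul_comm]

lemma conjTranspose_mul_eigenFrame [DecidableEq J] :
    (eigenFrame k ψ).conjTranspose * eigenFrame k ψ = 1 := by
  ext ⟨b, r, i⟩ ⟨c, q, j⟩
  rw [mul_eigenFrame_apply]
  simp only [Matrix.conjTranspose_apply, eigenFrame_apply_cons]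
  by_cases h : c = b ∧ q = r
  · obtain ⟨rfl, rfl⟩ := h
    simp only [and_self, if_true]
    rw [sum_star_mul_eq_ite]
    simp [Matrix.one_apply]
  · have h' : ¬ (b = c ∧ r = q ∧ i = j) := fun h' => h ⟨h'.1.symm, h'.2.1.symm⟩
    simp [h, h']

variable [DecidableEq S]

/-- Both index types have the same cardinality, so the left inverse is also a right inverse. -/
lemma eigenFrame_mul_conjTranspose :
    eigenFrame k ψ * (eigenFrame k ψ).conjTranspose = 1 := by
  classical
  refine (Matrix.mul_eq_one_comm_of_card_eq _ _ _ ?_).1 (conjTranspose_mul_eigenFrame ψ)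
  have h : Fintype.card J = Fintype.card S := by
    rw [← Module.finrank_eq_card_basis ψ.toBasis, finrank_euclideanSpace]
  simp [h, pow_succ]
  ring

/-- The circuit `C` preserves the spaces spanned by `|0⟩|r⟩|ψⱼ⟩` and `|1⟩|r⟩|ψⱼ⟩`, on which it
acts as `w (r, j)`. -/
def ActsAs (U : Matrix.unitaryGroup S ℂ) (ψ : OrthonormalBasis J ℂ (EuclideanSpace ℂ S))
    [DecidableEq J] (C : Circuit (k + 1))
    (w : (Fin k → Fin 2) × J → Matrix (Fin 2) (Fin 2) ℂ) : Prop :=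
  Circuit.toMatrix U C * eigenFrame k ψ = eigenFrame k ψ * Matrix.blockDiagonal w

lemma Circuit.toMatrix_append {q : ℕ} (U : Matrix.unitaryGroup S ℂ) (C D : Circuit q) :
    Circuit.toMatrix U (C ++ D) = Circuit.toMatrix U D * Circuit.toMatrix U C := by
  induction C with
  | nil => simp [Circuit.toMatrix]
  | cons g C ih =>
    change Circuit.toMatrix U (C ++ D) * g.toMatrix U = _
    rw [ih, Matrix.mul_assoc]
    rfl

variable {ψ} [DecidableEq J] {U : Matrix.unitaryGroup S ℂ}

lemma ActsAs.append {C D : Circuit (k + 1)} {w v : (Fin k → Fin 2) × J → Matrix (Fin 2) (Fin 2) ℂ}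
    (hC : ActsAs U ψ C w) (hD : ActsAs U ψ D v) :
    ActsAs U ψ (C ++ D) (fun q => v q * w q) := by
  unfold ActsAs at *
  rw [Circuit.toMatrix_append, Matrix.mul_assoc, hC, ← Matrix.mul_assoc, hD, Matrix.mul_assoc,
    Matrix.blockDiagonal_mul]

lemma actsAs_nil : ActsAs U ψ ([] : Circuit (k + 1)) (fun _ => 1) := by
  have : (fun _ : (Fin k → Fin 2) × J => (1 : Matrix (Fin 2) (Fin 2) ℂ)) = 1 := rfl
  unfold ActsAs
  rw [this, Matrix.blockDiagonal_one]
  simp [Circuit.toMatrix]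

lemma actsAs_singleton {g : Gate (k + 1)} {w : (Fin k → Fin 2) × J → Matrix (Fin 2) (Fin 2) ℂ}
    (h : ∀ a y s b r j, ∑ t, g.toMatrix U ((Fin.cons a y : Fin (k + 1) → Fin 2), s)
        ((Fin.cons b r : Fin (k + 1) → Fin 2), t) * ψ j t =
      if y = r then ψ j s * w (r, j) a b else 0) :
    ActsAs U ψ [g] w := by
  unfold ActsAs
  ext ⟨x, s⟩ ⟨b, r, j⟩
  obtain ⟨a, y, rfl⟩ : ∃ (a : Fin 2) (y : Fin k → Fin 2), x = Fin.cons a y :=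
    ⟨x 0, Fin.tail x, (Fin.cons_self_tail x).symm⟩
  rw [mul_eigenFrame_apply]
  simp only [Circuit.toMatrix, Matrix.one_mul]
  rw [h, Matrix.mul_apply, Fintype.sum_prod_type]
  simp only [Matrix.blockDiagonal_apply]
  rw [Finset.sum_comm]
  by_cases hr : y = r
  · rw [if_pos hr, Finset.sum_eq_single (r, j)]
    · rw [Finset.sum_eq_single a]
      · simp [eigenFrame_apply_cons, hr]
      · intro c _ hc
        simp [eigenFrame_apply_cons, hc.symm]
      · simp
    · intro q _ hq
      simp [hq]
    · simp
  · rw [if_neg hr]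
    refine (Finset.sum_eq_zero fun q _ => Finset.sum_eq_zero fun c _ => ?_).symm
    by_cases hq : q = (r, j)
    · subst hq; simp [eigenFrame_apply_cons, hr]
    · simp [hq]

lemma forall_ne_zero_cons_eq_iff (a b : Fin 2) (y r : Fin k → Fin 2) :
    (∀ c, c ≠ 0 → (Fin.cons a y : Fin (k + 1) → Fin 2) c = (Fin.cons b r : Fin (k + 1) → Fin 2) c)
      ↔ y = r := by
  constructor
  · intro h
    funext i
    simpa using h i.succ (Fin.succ_ne_zero i)
  · rintro rfl c hc
    obtain ⟨i, rfl⟩ := Fin.exists_succ_eq.2 hc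
    simp

lemma actsAs_one (G : Matrix.unitaryGroup (Fin 2) ℂ) :
    ActsAs U ψ [(.one 0 G : Gate (k + 1))] (fun _ => G.1) := by
  refine actsAs_singleton fun a y s b r j => ?_
  simp only [Gate.toMatrix, forall_ne_zero_cons_eq_iff, Fin.cons_zero]
  by_cases h : y = r <;> simp [h, mul_comm]

/-- The controlled phase gate. -/
def controlledPhase (c : ℂ) (hc : ‖c‖ = 1) : Matrix.unitaryGroup (Fin 2 × Fin 2) ℂ :=
  ⟨Matrix.diagonal fun p => if p = (1, 1) then c else 1, by
    have hcc : c * conj c = 1 := by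
      rw [Complex.mul_conj, Complex.normSq_eq_norm_sq, hc]; simp
    rw [Matrix.mem_unitaryGroup_iff, Matrix.star_eq_conjTranspose, Matrix.diagonal_conjTranspose,
      Matrix.diagonal_mul_diagonal, ← Matrix.diagonal_one]
    congr 1
    funext p
    by_cases h : p = (1, 1) <;> simp [h, hcc]⟩

lemma actsAs_controlledPhase (i : Fin k) (c : ℂ) (hc : ‖c‖ = 1) :
    ActsAs U ψ [(.two 0 i.succ (Fin.succ_ne_zero i).symm (controlledPhase c hc) : Gate (k + 1))]
      (fun q => Matrix.diagonal ![1, if q.1 i = 1 then c else 1]) := by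
  refine actsAs_singleton fun a y s b r j => ?_
  simp only [Gate.toMatrix, Fin.cons_zero, Fin.cons_succ, controlledPhase, Matrix.diagonal_apply,
    Prod.mk.injEq]
  by_cases hyr : y = r
  · subst hyr
    rw [if_pos rfl, Finset.sum_eq_single s]
    · have h : ∀ d : Fin (k + 1), d ≠ 0 → d ≠ i.succ →
          (Fin.cons a y : Fin (k + 1) → Fin 2) d = (Fin.cons b y : Fin (k + 1) → Fin 2) d :=
        fun d hd _ => (forall_ne_zero_cons_eq_iff a b y y).2 rfl d hd
      rw [if_pos ⟨rfl, h⟩]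
      fin_cases a <;> fin_cases b <;> simp [mul_comm]
    · intro t _ ht
      simp [ht.symm]
    · simp
  · rw [if_neg hyr]
    refine Finset.sum_eq_zero fun t _ => ?_
    by_cases hi : y i = r i
    · rw [if_neg, zero_mul]
      rintro ⟨-, h⟩
      apply hyr
      funext d
      by_cases hd : d = i
      · rw [hd, hi]
      · simpa using h d.succ (Fin.succ_ne_zero d) (fun h' => hd (Fin.succ_injective _ h'))
    · simp [hi]

variable {lam : J → ℝ}

lemma IsEigendecomposition.mulVec_eq (h : IsEigendecomposition U ψ lam) (s : S) (j : J) :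
    ∑ t, (U : Matrix S S ℂ) s t * ψ j t =
      ψ j s * Complex.exp (2 * Real.pi * Complex.I * (lam j : ℂ)) := by
  unfold IsEigendecomposition at h
  rw [h]
  simp only [Matrix.sum_apply, Matrix.smul_apply, Matrix.vecMulVec_apply, smul_eq_mul,
    Finset.sum_mul]
  rw [Finset.sum_comm]
  have : ∀ i, ∑ t, Complex.exp (2 * Real.pi * Complex.I * (lam i : ℂ)) *
      (ψ i s * star (ψ i t)) * ψ j t = Complex.exp (2 * Real.pi * Complex.I * (lam i : ℂ)) *
        ψ i s * (if i = j then 1 else 0) := fun i => by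
    rw [← sum_star_mul_eq_ite ψ, Finset.mul_sum]
    exact Finset.sum_congr rfl fun t _ => by ring
  rw [Finset.sum_congr rfl fun i _ => this i]
  simp [mul_comm]

lemma IsEigendecomposition.actsAs_ctrlU (h : IsEigendecomposition U ψ lam) :
    ActsAs U ψ [(.ctrlU 0 : Gate (k + 1))]
      (fun q => Matrix.diagonal ![1, Complex.exp (2 * Real.pi * Complex.I * (lam q.2 : ℂ))]) := by
  refine actsAs_singleton fun a y s b r j => ?_
  simp only [Gate.toMatrix, controlled, Fin.cons_inj, Fin.cons_zero]
  by_cases hyr : y = r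
  · by_cases hab : a = b
    · subst hab hyr
      fin_cases a
      · simp [Matrix.one_apply]
      · simp [h.mulVec_eq]
    · simp [hab]
  · simp [hyr]

lemma actsAs_map_diagonal {ι : Type*} (l : List ι) (g : ι → Gate (k + 1))
    (f : ι → (Fin k → Fin 2) × J → ℂ)
    (h : ∀ i, ActsAs U ψ [g i] (fun q => Matrix.diagonal ![1, f i q])) :
    ActsAs U ψ (l.map g) (fun q => Matrix.diagonal ![1, (l.map fun i => f i q).prod]) := by
  have hd : ∀ x y : ℂ, Matrix.diagonal ![1, x] * Matrix.diagonal ![1, y] =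
      Matrix.diagonal ![1, y * x] := fun x y => by
    rw [Matrix.diagonal_mul_diagonal]
    congr 1
    funext i
    fin_cases i <;> simp [mul_comm]
  induction l with
  | nil =>
    convert! actsAs_nil (U := U) (ψ := ψ) (k := k) using 2
    rw [← Matrix.diagonal_one]
    congr 1
    funext i
    fin_cases i <;> simp
  | cons i l ih =>
    have := (h i).append ih
    simp only [hd] at this
    simpa using this

end Blocks

section Nearby

open scoped ComplexConjugate Matrix.Norms.L2Operator

/-! ### Unitaries close to a given one -/

lemma l2_opNorm_one_le {ι : Type*} [Fintype ι] [DecidableEq ι] :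
    ‖(1 : Matrix ι ι ℂ)‖ ≤ 1 := by
  rw [← Matrix.diagonal_one, Matrix.l2_opNorm_diagonal]
  exact (pi_norm_le_iff_of_nonneg zero_le_one).2 fun _ => by simp

lemma l2_opNorm_le_one_of_conjTranspose_mul_self {m n : Type*} [Fintype m] [Fintype n]
    [DecidableEq m] [DecidableEq n] {A : Matrix m n ℂ} (h : A.conjTranspose * A = 1) :
    ‖A‖ ≤ 1 := by
  have h1 := Matrix.l2_opNorm_conjTranspose_mul_self A
  rw [h] at h1
  nlinarith [l2_opNorm_one_le (ι := n), norm_nonneg A]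

/-- The columns are orthogonal and of equal norm, so `M†M` is scalar. Operator distances thus reduce
to distances of first columns. -/
lemma norm_sq_quaternion_le (a b : ℂ) :
    ‖!![a, -conj b; b, conj a]‖ ^ 2 ≤ ‖a‖ ^ 2 + ‖b‖ ^ 2 := by
  have h : (!![a, -conj b; b, conj a] : Matrix (Fin 2) (Fin 2) ℂ).conjTranspose *
      !![a, -conj b; b, conj a] = ((‖a‖ ^ 2 + ‖b‖ ^ 2 : ℝ) : ℂ) • 1 := by
    have h1 : ((‖a‖ ^ 2 + ‖b‖ ^ 2 : ℝ) : ℂ) = a * conj a + b * conj b := by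
      rw [Complex.mul_conj, Complex.mul_conj, Complex.normSq_eq_norm_sq,
        Complex.normSq_eq_norm_sq, Complex.ofReal_add]
    rw [h1]
    ext i j
    fin_cases i <;> fin_cases j <;>
      simp [Matrix.mul_apply, Fin.sum_univ_two, Matrix.conjTranspose_apply] <;> ring
  rw [pow_two, ← Matrix.l2_opNorm_conjTranspose_mul_self, h, norm_smul, Complex.norm_real,
    Real.norm_of_nonneg (by positivity)]
  exact mul_le_of_le_one_right (by positivity) l2_opNorm_one_le

/-- If an entry in the first column of a one-qubit unitary `W` has modulus close to one, then `W`
is close to a unitary which maps `|0⟩` to a multiple of the corresponding basis vector. -/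
lemma exists_near_unitary (W : Matrix.unitaryGroup (Fin 2) ℂ) (b : Fin 2) :
    ∃ (V : Matrix.unitaryGroup (Fin 2) ℂ) (φ : ℝ),
      (∀ c, V.1 c 0 = if c = b then Complex.exp (Complex.I * φ) else 0) ∧
      ‖W.1 - V.1‖ ^ 2 ≤ 2 - 2 * ‖W.1 b 0‖ := by
  have hW : W.1 0 0 * conj (W.1 0 0) + W.1 1 0 * conj (W.1 1 0) = 1 := by
    have h := congrFun (congrFun (Matrix.mem_unitaryGroup_iff'.1 W.2) 0) 0
    simp only [Matrix.mul_apply, Fin.sum_univ_two, Matrix.star_apply, Matrix.one_apply_eq] at h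
    simp only [RCLike.star_def] at h
    linear_combination h
  have hWn : ‖W.1 0 0‖ ^ 2 + ‖W.1 1 0‖ ^ 2 = 1 := by
    rw [Complex.mul_conj, Complex.mul_conj, Complex.normSq_eq_norm_sq,
      Complex.normSq_eq_norm_sq] at hW
    exact_mod_cast hW
  set φ := Complex.arg (W.1 b 0) with hφ
  set e := Complex.exp (Complex.I * φ) with he
  have hee : e * conj e = 1 := by
    rw [he, Complex.mul_conj, Complex.normSq_eq_norm_sq, mul_comm, Complex.norm_exp_ofReal_mul_I]
    simp
  have hdist : ‖W.1 b 0 - e‖ ^ 2 = (1 - ‖W.1 b 0‖) ^ 2 := by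
    have h1 : W.1 b 0 - e = ((‖W.1 b 0‖ - 1 : ℝ) : ℂ) * e := by
      conv_lhs => rw [← Complex.norm_mul_exp_arg_mul_I (W.1 b 0)]
      rw [he, mul_comm Complex.I, hφ]
      push_cast
      ring
    have h2 : ‖e‖ = 1 := by
      rw [he, mul_comm, Complex.norm_exp_ofReal_mul_I]
    rw [h1, norm_mul, h2, mul_one, Complex.norm_real, Real.norm_eq_abs, sq_abs]
    ring
  -- `K` has first column `(1, 0)`. Using it as a common right factor of `W` and of the new unitary
  -- leaves a difference of two completions, again of quaternion form.
  set K := star (completion _ _ hW) * W with hK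
  have hWK : W = completion _ _ hW * K := by
    rw [hK, ← mul_assoc, Unitary.mul_star_self, one_mul]
  have hK0 : K.1 0 0 = 1 := by
    rw [hK]
    simp [completion, Matrix.mul_apply, Fin.sum_univ_two, Matrix.star_apply]
    linear_combination hW
  have hK1 : K.1 1 0 = 0 := by
    rw [hK]
    simp [completion, Matrix.mul_apply, Fin.sum_univ_two, Matrix.star_apply]
    ring
  -- The new column keeps the phase of the large entry `w`. The squared distance is `(1 - |w|)²`
  -- plus the squared modulus `1 - |w|²` of the other entry.
  obtain ⟨p, q, hpq, hcol, hnorm⟩ : ∃ (p q : ℂ) (hpq : p * conj p + q * conj q = 1),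
      (∀ c, ![p, q] c = if c = b then e else 0) ∧
      ‖W.1 0 0 - p‖ ^ 2 + ‖W.1 1 0 - q‖ ^ 2 = 2 - 2 * ‖W.1 b 0‖ := by
    fin_cases b
    · refine ⟨e, 0, by simp [hee], fun c => by fin_cases c <;> simp, ?_⟩
      simp only [Fin.zero_eta] at hdist ⊢
      rw [hdist, sub_zero]
      linear_combination hWn
    · refine ⟨0, e, by simp [hee], fun c => by fin_cases c <;> simp, ?_⟩
      simp only [Fin.mk_one] at hdist ⊢
      rw [hdist, sub_zero]
      linear_combination hWn
  refine ⟨completion p q hpq * K, φ, fun c => ?_, ?_⟩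
  · rw [← he, ← hcol]
    fin_cases c <;>
    simp [completion, Matrix.mul_apply, Fin.sum_univ_two, hK0, hK1]
  · have h1 : W.1 - (completion p q hpq * K).1 =
        !![W.1 0 0 - p, -conj (W.1 1 0 - q); W.1 1 0 - q, conj (W.1 0 0 - p)] * K.1 := by
      clear_value K
      have hWv : W.1 = (completion _ _ hW).1 * K.1 := congrArg Subtype.val hWK
      refine (congrArg (· - (completion p q hpq * K).1) hWv).trans ?_
      simp only [Submonoid.coe_mul]
      rw [← Matrix.sub_mul]
      congr 1
      ext i j
      fin_cases i <;> fin_cases j <;> simp [completion]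
      ring
    have hKn : ‖K.1‖ ≤ 1 :=
      l2_opNorm_le_one_of_conjTranspose_mul_self (Matrix.mem_unitaryGroup_iff'.1 K.2)
    rw [← hnorm, h1]
    refine le_trans ?_ (norm_sq_quaternion_le _ _)
    gcongr
    exact (norm_mul_le _ _).trans (mul_le_of_le_one_right (norm_nonneg _) hKn)

end Nearby

/-! ### Operators that are block diagonal in the eigenbasis -/

section Frame

open scoped Matrix.Norms.L2Operator

variable {k : ℕ} {S : Type u} [Fintype S] [DecidableEq S] {J : Type v} [Fintype J] [DecidableEq J]
  (ψ : OrthonormalBasis J ℂ (EuclideanSpace ℂ S))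

/-- The operator that acts as `w (r, j)` on the span of `|0⟩|r⟩|ψⱼ⟩` and `|1⟩|r⟩|ψⱼ⟩`. -/
def frameOperator (w : (Fin k → Fin 2) × J → Matrix (Fin 2) (Fin 2) ℂ) :
    Matrix ((Fin (k + 1) → Fin 2) × S) ((Fin (k + 1) → Fin 2) × S) ℂ :=
  eigenFrame k ψ * Matrix.blockDiagonal w * (eigenFrame k ψ).conjTranspose

lemma frameOperator_mul_eigenFrame (w : (Fin k → Fin 2) × J → Matrix (Fin 2) (Fin 2) ℂ) :
    frameOperator ψ w * eigenFrame k ψ = eigenFrame k ψ * Matrix.blockDiagonal w := by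
  rw [frameOperator, Matrix.mul_assoc, conjTranspose_mul_eigenFrame, Matrix.mul_one]

lemma ActsAs.toMatrix_eq {U : Matrix.unitaryGroup S ℂ} {C : Circuit (k + 1)}
    {w : (Fin k → Fin 2) × J → Matrix (Fin 2) (Fin 2) ℂ} (h : ActsAs U ψ C w) :
    Circuit.toMatrix U C = frameOperator ψ w := by
  rw [frameOperator, ← h, Matrix.mul_assoc, eigenFrame_mul_conjTranspose, Matrix.mul_one]

lemma frameOperator_mem_unitaryGroup {w : (Fin k → Fin 2) × J → Matrix (Fin 2) (Fin 2) ℂ}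
    (h : ∀ q, w q ∈ Matrix.unitaryGroup (Fin 2) ℂ) :
    frameOperator ψ w ∈ Matrix.unitaryGroup ((Fin (k + 1) → Fin 2) × S) ℂ := by
  have h1 : Matrix.blockDiagonal w * (Matrix.blockDiagonal w).conjTranspose = 1 := by
    rw [Matrix.blockDiagonal_conjTranspose, ← Matrix.blockDiagonal_mul,
      ← Matrix.blockDiagonal_one]
    congr 1
    funext q
    exact Matrix.mem_unitaryGroup_iff.1 (h q)
  rw [Matrix.mem_unitaryGroup_iff, Matrix.star_eq_conjTranspose]
  nth_rw 1 [frameOperator]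
  rw [frameOperator, Matrix.conjTranspose_mul, Matrix.conjTranspose_mul,
    Matrix.conjTranspose_conjTranspose]
  calc _ = eigenFrame k ψ * (Matrix.blockDiagonal w * (((eigenFrame k ψ).conjTranspose *
        eigenFrame k ψ) * (Matrix.blockDiagonal w).conjTranspose)) *
          (eigenFrame k ψ).conjTranspose := by simp only [Matrix.mul_assoc]
    _ = 1 := by
        rw [conjTranspose_mul_eigenFrame, Matrix.one_mul, h1, Matrix.mul_one,
          eigenFrame_mul_conjTranspose]

lemma norm_frameOperator_sub_le {w v : (Fin k → Fin 2) × J → Matrix (Fin 2) (Fin 2) ℂ} {c : ℝ}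
    (hc : 0 ≤ c) (h : ∀ q, ‖w q - v q‖ ≤ c) :
    ‖frameOperator ψ w - frameOperator ψ v‖ ≤ c := by
  have hB : ‖eigenFrame k ψ‖ ≤ 1 :=
    l2_opNorm_le_one_of_conjTranspose_mul_self (conjTranspose_mul_eigenFrame ψ)
  have h1 : frameOperator ψ w - frameOperator ψ v = frameOperator ψ (w - v) := by
    simp only [frameOperator, Matrix.blockDiagonal_sub, Matrix.mul_sub, Matrix.sub_mul]
  have h2 : ‖Matrix.blockDiagonal (w - v)‖ ≤ c := norm_blockDiagonal_le _ hc h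
  rw [h1, frameOperator]
  refine (Matrix.l2_opNorm_mul _ _).trans ?_
  rw [Matrix.l2_opNorm_conjTranspose]
  refine (mul_le_of_le_one_right (norm_nonneg _) hB).trans ?_
  refine (Matrix.l2_opNorm_mul _ _).trans ?_
  exact (mul_le_of_le_one_left (norm_nonneg _) hB).trans h2

lemma frameOperator_mulVec_registerState
    (w : (Fin k → Fin 2) × J → Matrix (Fin 2) (Fin 2) ℂ) (b : Fin 2) (c : ℂ) (x : ℕ) (j : J)
    (h : ∀ a, w (binary k x, j) a 0 = if a = b then c else 0) :
    (frameOperator ψ w).mulVec (registerState 0 x (ψ j)) = c • registerState b x (ψ j) := by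
  funext p
  have h1 := congrFun (congrFun (frameOperator_mul_eigenFrame ψ w) p) (0, (binary k x, j))
  rw [Matrix.mul_apply, Matrix.mul_apply] at h1
  refine h1.trans ?_
  rw [Fintype.sum_prod_type, Finset.sum_eq_single b]
  · rw [Finset.sum_eq_single (binary k x, j)]
    · simp [Matrix.blockDiagonal_apply, h, eigenFrame, registerState, mul_comm]
    · intro q _ hq
      simp [Matrix.blockDiagonal_apply, hq]
    · simp
  · intro a _ ha
    refine Finset.sum_eq_zero fun q _ => ?_
    by_cases hq : q = (binary k x, j)
    · subst hq
      simp [Matrix.blockDiagonal_apply, h, ha]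
    · simp [Matrix.blockDiagonal_apply, hq]
  · simp

end Frame

/-! ### The iterative phase estimation circuit -/

section SignalCircuit

variable {k : ℕ}

/-- The one-qubit phase gate. -/
def phaseGate (c : ℂ) (hc : ‖c‖ = 1) : Matrix.unitaryGroup (Fin 2) ℂ :=
  ⟨Matrix.diagonal ![1, c], diagonal_mem_unitaryGroup hc⟩

lemma norm_exp_neg_mul_I (x : ℝ) : ‖Complex.exp (-(x : ℂ) * Complex.I)‖ = 1 := by
  rw [← Complex.ofReal_neg, Complex.norm_exp_ofReal_mul_I]

/-- The circuit for the signal operator: `N` controlled calls to the oracle, followed by phases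
that subtract from the phase of the output qubit `π Δ / 2 ^ k`, where `Δ` is the content of the
register, and a constant. -/
def signalCircuit (k N : ℕ) (θ : ℝ) : Circuit (k + 1) :=
  (List.replicate N () |>.map fun _ => .ctrlU 0) ++
    ((List.finRange k).map fun i => .two 0 i.succ (Fin.succ_ne_zero i).symm
      (controlledPhase (Complex.exp (-((Real.pi * 2 ^ (k - 1 - (i : ℕ)) / 2 ^ k : ℝ) : ℂ) *
        Complex.I)) (norm_exp_neg_mul_I _))) ++
    [.one 0 (phaseGate (Complex.exp (-(θ : ℂ) * Complex.I)) (norm_exp_neg_mul_I θ))]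

/-- The signal processing circuit with rotations `G` and `L`. -/
def processingCircuit (k N : ℕ) (θ : ℝ) (G : Matrix.unitaryGroup (Fin 2) ℂ) :
    List (Matrix.unitaryGroup (Fin 2) ℂ) → Circuit (k + 1)
  | [] => [.one 0 G]
  | H :: L => processingCircuit k N θ G L ++ (signalCircuit k N θ ++ [.one 0 H])

lemma Circuit.queries_append {q : ℕ} (C D : Circuit q) :
    Circuit.queries (C ++ D) = C.queries + D.queries := by
  simp [Circuit.queries]

lemma queries_signalCircuit (k N : ℕ) (θ : ℝ) : (signalCircuit k N θ).queries = N := by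
  simp [signalCircuit, Circuit.queries, Gate.queries, Function.comp_def]

lemma queries_processingCircuit (k N : ℕ) (θ : ℝ) (G : Matrix.unitaryGroup (Fin 2) ℂ)
    (L : List (Matrix.unitaryGroup (Fin 2) ℂ)) :
    (processingCircuit k N θ G L).queries = L.length * N := by
  induction L with
  | nil => simp [processingCircuit, Circuit.queries, Gate.queries]
  | cons H L ih =>
    rw [processingCircuit, Circuit.queries_append, Circuit.queries_append, ih,
      queries_signalCircuit]
    simp [Circuit.queries, Gate.queries]
    ring

variable {S : Type u} [Fintype S] [DecidableEq S] {J : Type v} [Fintype J] [DecidableEq J]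
  {ψ : OrthonormalBasis J ℂ (EuclideanSpace ℂ S)} {U : Matrix.unitaryGroup S ℂ} {lam : J → ℝ}

/-- The number whose binary expansion is `r`, most significant bit first. -/
def ofBits (r : Fin k → Fin 2) : ℕ := ∑ i, (r i : ℕ) * 2 ^ (k - 1 - (i : ℕ))

lemma sum_bits (x : ℕ) (k : ℕ) : ∑ i ∈ Finset.range k, x / 2 ^ i % 2 * 2 ^ i = x % 2 ^ k := by
  induction k with
  | zero => simp [Nat.mod_one]
  | succ k ih => rw [Finset.sum_range_succ, ih, Nat.mod_pow_succ, mul_comm (2 ^ k)]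

lemma ofBits_binary {x : ℕ} (hx : x < 2 ^ k) : ofBits (binary k x) = x := by
  have h := sum_bits x k
  rw [Nat.mod_eq_of_lt hx, ← Finset.sum_range_reflect, Finset.sum_range] at h
  exact h

/-- The angle of the signal on the span of `|0⟩|r⟩|ψⱼ⟩` and `|1⟩|r⟩|ψⱼ⟩`. -/
def signalAngle (N : ℕ) (θ : ℝ) (lam : J → ℝ) (q : (Fin k → Fin 2) × J) : ℝ :=
  2 * Real.pi * N * lam q.2 - Real.pi * ofBits q.1 / 2 ^ k - θ

lemma actsAs_signalCircuit (h : IsEigendecomposition U ψ lam) (N : ℕ) (θ : ℝ) :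
    ActsAs U ψ (signalCircuit k N θ) (fun q =>
      Matrix.diagonal ![1, Complex.exp ((signalAngle N θ lam q : ℝ) * Complex.I)]) := by
  have h1 := actsAs_map_diagonal (List.replicate N ()) (fun _ => (.ctrlU 0 : Gate (k + 1))) _
    (fun _ => h.actsAs_ctrlU)
  have h2 := actsAs_map_diagonal (U := U) (ψ := ψ) (List.finRange k) (fun i => .two 0 i.succ
      (Fin.succ_ne_zero i).symm (controlledPhase
      (Complex.exp (-((Real.pi * 2 ^ (k - 1 - (i : ℕ)) / 2 ^ k : ℝ) : ℂ) * Complex.I))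
      (norm_exp_neg_mul_I _))) _ (fun i => actsAs_controlledPhase i _ _)
  have h3 := (h1.append h2).append (actsAs_one (U := U) (ψ := ψ) (k := k)
    (phaseGate (Complex.exp (-(θ : ℂ) * Complex.I)) (norm_exp_neg_mul_I θ)))
  unfold signalCircuit
  convert! h3 using 2 with q
  rw [phaseGate, Matrix.diagonal_mul_diagonal, Matrix.diagonal_mul_diagonal]
  congr 1
  funext i
  fin_cases i
  · simp
  have h4 : ∀ i : Fin k, (if q.1 i = 1 then
      Complex.exp (-((Real.pi * 2 ^ (k - 1 - (i : ℕ)) / 2 ^ k : ℝ) : ℂ) * Complex.I) else 1) =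
      Complex.exp (-((Real.pi / 2 ^ k * ((q.1 i : ℕ) * 2 ^ (k - 1 - (i : ℕ)) : ℕ) : ℝ) : ℂ) *
        Complex.I) := by
    intro i
    rcases (show q.1 i = 0 ∨ q.1 i = 1 by omega) with h | h
    · simp [h]
    · rw [if_pos h, h]
      congr 3
      push_cast
      simp
      ring
  simp only [Fin.mk_one, Matrix.cons_val_one, Matrix.cons_val_fin_one, List.map_replicate,
    List.prod_replicate, h4, ← List.ofFn_eq_map, List.prod_ofFn]
  rw [← Complex.exp_sum, ← Finset.sum_mul, Finset.sum_neg_distrib, ← Complex.ofReal_sum,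
    ← Finset.mul_sum, ← Nat.cast_sum, ← Complex.exp_nat_mul, ← Complex.exp_add,
    ← Complex.exp_add]
  congr 1
  rw [signalAngle, ofBits]
  push_cast
  ring

lemma actsAs_processingCircuit (h : IsEigendecomposition U ψ lam) (N : ℕ) (θ : ℝ)
    (G : Matrix.unitaryGroup (Fin 2) ℂ) (L : List (Matrix.unitaryGroup (Fin 2) ℂ)) :
    ActsAs U ψ (processingCircuit k N θ G L) (fun q =>
      signalProduct (Complex.exp ((signalAngle N θ lam q : ℝ) * Complex.I)) G L) := by
  induction L with
  | nil => exact actsAs_one G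
  | cons H L ih =>
    have := ih.append ((actsAs_signalCircuit h N θ).append (actsAs_one H))
    simpa only [processingCircuit, signalProduct, Matrix.mul_assoc] using this

end SignalCircuit

/-! ### Separation of the two bit values, and the error budget -/

section Correctness

open Polynomial

/-- For `k = 0` this is Jordan's inequality `sin (πα/2) ≥ α`. For `k ≥ 1` put `t = 2^{-k} ≤ 1/2`:
then `|y| ≤ 2t`, so `cos y ≥ 1 - 2t² ≥ 1 - t ≥ 1 - t (1 + α)`. -/
lemma two_mul_ampGap_le_cos {k : ℕ} {α y : ℝ} (h0 : 0 < α) (h1 : α < 1)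
    (hy : |y| ≤ Real.pi * ((1 - α) / 2) / 2 ^ k) : 2 * ampGap k α ≤ Real.cos y := by
  have hpi := Real.pi_pos
  unfold ampGap
  split_ifs with hk
  · subst hk
    rw [← Real.cos_abs]
    have h2 : Real.cos (Real.pi * ((1 - α) / 2)) ≤ Real.cos |y| :=
      Real.cos_le_cos_of_nonneg_of_le_pi (abs_nonneg y) (by nlinarith) (by simpa using hy)
    have h3 : Real.cos (Real.pi * ((1 - α) / 2)) = Real.sin (Real.pi / 2 * α) := by
      rw [← Real.cos_pi_div_two_sub]
      ring_nf
    have h4 := Real.mul_le_sin (x := Real.pi / 2 * α) (by positivity) (by nlinarith)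
    have h5 : 2 / Real.pi * (Real.pi / 2 * α) = α := by field_simp
    linarith
  · have h2 := Real.one_sub_sq_div_two_le_cos (x := y)
    have ht : (2 : ℝ) ≤ 2 ^ k := by
      calc (2 : ℝ) = 2 ^ 1 := (pow_one _).symm
        _ ≤ 2 ^ k := pow_le_pow_right₀ (by norm_num) (Nat.one_le_iff_ne_zero.2 hk)
    set t : ℝ := 1 / 2 ^ k with hteq
    have ht0 : 0 < t := by positivity
    have ht2 : t ≤ 1 / 2 := one_div_le_one_div_of_le (by norm_num) ht
    have h3 : |y| ≤ 2 * t := by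
      refine hy.trans ?_
      rw [div_eq_mul_one_div, ← hteq]
      have := Real.pi_lt_four
      gcongr
      nlinarith
    have h4 : y ^ 2 ≤ (2 * t) ^ 2 := by
      rw [← sq_abs]
      gcongr
    nlinarith

end Correctness

section Correctness

open Polynomial
open scoped Matrix.Norms.L2Operator

/-- The signal determines the bit `k`: it lies within a quarter turn of `1` or of `-1`. -/
lemma cos_signalAngle {n k : ℕ} (hk : k < n) {α : ℝ} (h0 : 0 < α) (h1 : α < 1) {J : Type v}
    {lam : J → ℝ} (hlam : RoundingPromise n α lam) (j : J) :
    ∃ c : ℝ, 2 * ampGap k α ≤ c ∧ c ≤ 1 ∧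
      Real.cos (signalAngle (2 ^ (n - k - 1)) (Real.pi * ((1 + α) / 2) / 2 ^ k) lam
        (binary k (leastBits n k (lam j)), j)) = if bit n k (lam j) = 0 then c else -c := by
  obtain ⟨hl0, hl1, hl⟩ := hlam j
  have h2n : (0 : ℝ) < 2 ^ n := by positivity
  have h2k : (0 : ℝ) < 2 ^ k := by positivity
  set E := estimate n (lam j) with hE
  have hE1 : (E : ℝ) ≤ 2 ^ n * lam j := Nat.floor_le (by positivity)
  have hE2 : 2 ^ n * lam j < E + 1 := Nat.lt_floor_add_one _
  set f := 2 ^ n * lam j - E with hf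
  have hEn : E ≤ 2 ^ n := by
    have h : (E : ℝ) ≤ (2 ^ n : ℕ) := by push_cast; nlinarith
    exact_mod_cast h
  -- Otherwise the phase would lie in the forbidden interval with `x = E`.
  have hfα : α < f := by
    by_contra hcon
    push Not at hcon
    refine hl E hEn ⟨?_, ?_⟩
    · rw [div_le_iff₀ h2n]; linarith
    · rw [← add_div, le_div_iff₀ h2n]; linarith
  set y := Real.pi * (f - (1 + α) / 2) / 2 ^ k with hy
  have hyle : |y| ≤ Real.pi * ((1 - α) / 2) / 2 ^ k := by
    rw [hy, abs_div, abs_mul, abs_of_pos Real.pi_pos, abs_of_pos h2k]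
    have : |f - (1 + α) / 2| ≤ (1 - α) / 2 := abs_le.2 ⟨by linarith, by linarith⟩
    have := Real.pi_pos
    gcongr
  refine ⟨Real.cos y, two_mul_ampGap_le_cos h0 h1 hyle, Real.cos_le_one y, ?_⟩
  have hdm : (2 ^ k : ℝ) * (E / 2 ^ k : ℕ) + leastBits n k (lam j) = E := by
    exact_mod_cast Nat.div_add_mod E (2 ^ k)
  have hpow : (2 : ℝ) ^ n = 2 * 2 ^ (n - k - 1) * 2 ^ k := by
    rw [← pow_succ', ← pow_add]
    congr 1
    omega
  have hangle : signalAngle (2 ^ (n - k - 1)) (Real.pi * ((1 + α) / 2) / 2 ^ k) lam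
      (binary k (leastBits n k (lam j)), j) = y + (E / 2 ^ k : ℕ) * Real.pi := by
    have hlt : leastBits n k (lam j) < 2 ^ k := Nat.mod_lt _ (by positivity)
    simp only [signalAngle]
    rw [ofBits_binary hlt, hy]
    push_cast
    have h3 : 2 * Real.pi * 2 ^ (n - k - 1) * lam j = Real.pi * (f + E) / 2 ^ k := by
      rw [hf, sub_add_cancel, hpow]
      field_simp
    rw [h3, ← hdm]
    field_simp
    ring
  rw [hangle, Real.cos_add_nat_mul_pi]
  have hbit : bit n k (lam j) = 0 ↔ Even (E / 2 ^ k) := by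
    rw [bit, ← hE, Fin.ext_iff, Nat.even_iff]
    simp [Fin.ofNat]
  split_ifs with hb
  · rw [(hbit.1 hb).neg_one_pow, one_mul]
  · rw [(Nat.not_even_iff_odd.1 (mt hbit.2 hb)).neg_one_pow, neg_one_mul]

/-- Rotations that process the signal `z` according to a polynomial bounded by one. -/
lemma exists_rotations {A : ℝ[X]} {M : ℕ} (hdeg : A.natDegree ≤ M)
    (hA : ∀ x : ℝ, 0 ≤ x → x ≤ 1 → 0 ≤ A.eval x ∧ A.eval x ≤ 1) :
    ∃ (G : Matrix.unitaryGroup (Fin 2) ℂ) (L : List (Matrix.unitaryGroup (Fin 2) ℂ)),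
      L.length = 2 * M ∧ ∀ z : ℂ, ‖z‖ = 1 →
        ‖signalProduct z G L 0 0‖ ^ 2 = 1 - A.eval ((1 + z.re) / 2) ^ 2 ∧
        ‖signalProduct z G L 1 0‖ ^ 2 = A.eval ((1 + z.re) / 2) ^ 2 := by
  set q : ℝ[X] := A.comp (C (1 / 2) + C (1 / 2) * X) with hq
  have hqe : ∀ x, q.eval x = A.eval ((1 + x) / 2) := fun x => by
    rw [hq, eval_comp]
    congr 1
    simp
    ring
  have hqd : (q ^ 2).natDegree ≤ 2 * M := by
    refine natDegree_pow_le.trans (Nat.mul_le_mul_left 2 ?_)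
    refine natDegree_comp_le.trans ?_
    calc _ ≤ M * 1 := Nat.mul_le_mul hdeg (by compute_degree)
      _ = M := mul_one M
  have hb : ∀ x, -1 ≤ x → x ≤ 1 → 0 ≤ q.eval x ∧ q.eval x ≤ 1 := fun x hx hx' => by
    rw [hqe]
    exact hA _ (by linarith) (by linarith)
  have hPd : (1 - q ^ 2).natDegree ≤ 2 * M :=
    (natDegree_sub_le _ _).trans (max_le (by simp) hqd)
  -- Factoring the squares makes `A` itself the modulus of the amplitude of `|1⟩`; the degree `2M`
  -- is what fixes the number of signal uses.
  obtain ⟨P, hPdeg, hP⟩ := (hasCircleFactor_of_nonneg _ (1 - q ^ 2) rfl fun x hx hx' => by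
    obtain ⟨h1, h2⟩ := hb x hx hx'
    simp only [eval_sub, eval_one, eval_pow]
    nlinarith).mono hPd
  obtain ⟨Q, hQdeg, hQ⟩ := (hasCircleFactor_of_nonneg _ (q ^ 2) rfl fun x _ _ => by
    rw [eval_pow]
    positivity).mono hqd
  obtain ⟨G, L, hL, h⟩ := exists_signalProduct_column (2 * M) P Q hPdeg hQdeg fun z hz => by
    rw [hP z hz, hQ z hz]
    simp
  refine ⟨G, L, hL, fun z hz => ?_⟩
  rw [(h z hz).1, (h z hz).2, hP z hz, hQ z hz]
  simp [hqe]

theorem exists_circuit {n k : ℕ} {α δ m : ℝ} (hk : k < n) (h0 : 0 < α) (h1 : α < 1)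
    (hδ : 0 < δ) {M : ℕ} (hM : IsAmplifyingDegree (ampGap k α) (ampError m δ) M) :
    ∃ C : Circuit (k + 1), C.queries = 2 ^ (n - k) * M ∧
      IsIterativePhaseEstimatorWithPhases.{u, v} n α k δ C := by
  obtain ⟨-, hdeg, hA, hlow, hhigh⟩ := hM
  set A := ampPoly (ampGap k α) (ampError m δ) M
  obtain ⟨G, L, hL, hGL⟩ := exists_rotations hdeg.le hA
  set N := 2 ^ (n - k - 1) with hN
  set θ := Real.pi * ((1 + α) / 2) / 2 ^ k with hθ
  refine ⟨processingCircuit k N θ G L, ?_, ?_⟩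
  · rw [queries_processingCircuit, hL, hN]
    have : 2 ^ (n - k) = 2 ^ (n - k - 1) * 2 := by
      rw [← pow_succ]
      congr 1
      omega
    rw [this]
    ring
  intro S _ _ J _ U ψ lam hU hlam
  classical
  have hacts := actsAs_processingCircuit (k := k) hU N θ G L
  set w : (Fin k → Fin 2) × J → Matrix (Fin 2) (Fin 2) ℂ := fun q =>
    signalProduct (Complex.exp ((signalAngle N θ lam q : ℝ) * Complex.I)) G L with hw
  have hwU : ∀ q, w q ∈ Matrix.unitaryGroup (Fin 2) ℂ := fun q =>
    signalProduct_mem_unitaryGroup (Complex.norm_exp_ofReal_mul_I _) G L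
  choose v' φ' hv' hvw using fun j =>
    exists_near_unitary ⟨_, hwU (binary k (leastBits n k (lam j)), j)⟩ (bit n k (lam j))
  -- Blocks whose register content is not `Δ_k(λⱼ)` are unconstrained, so the circuit's own action
  -- is kept and no error arises there.
  set v : (Fin k → Fin 2) × J → Matrix (Fin 2) (Fin 2) ℂ := fun q =>
    if q.1 = binary k (leastBits n k (lam q.2)) then (v' q.2).1 else w q with hv
  have hvU : ∀ q, v q ∈ Matrix.unitaryGroup (Fin 2) ℂ := fun q => by
    simp only [hv]
    split_ifs
    · exact (v' q.2).2
    · exact hwU q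
  have hentry : ∀ j, 1 - ampError m δ ≤
      ‖w (binary k (leastBits n k (lam j)), j) (bit n k (lam j)) 0‖ := by
    intro j
    obtain ⟨c, hc, hc1, hcos⟩ := cos_signalAngle hk h0 h1 hlam j
    obtain ⟨hP, hQ⟩ := hGL (Complex.exp ((signalAngle N θ lam
      (binary k (leastBits n k (lam j)), j) : ℝ) * Complex.I)) (Complex.norm_exp_ofReal_mul_I _)
    rw [Complex.exp_ofReal_mul_I_re, hcos] at hP hQ
    have hneg := Real.neg_one_le_cos (signalAngle N θ lam (binary k (leastBits n k (lam j)), j))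
    rw [hcos] at hneg
    by_cases hb : bit n k (lam j) = 0
    · rw [if_pos hb] at hP hneg
      obtain ⟨ha0, ha1⟩ := hA ((1 + c) / 2) (by linarith) (by linarith)
      have ha := hhigh ((1 + c) / 2) (by linarith) (by linarith)
      rw [hb]
      -- For `0 ≤ A ≤ 1`, `√(1 - A²) ≥ 1 - A ≥ 1 - δ_amp`.
      refine le_trans (by linarith) (abs_le_of_sq_le_sq' (a := 1 - A.eval ((1 + c) / 2)) ?_
        (norm_nonneg _)).2
      rw [hP]
      nlinarith
    · have hb1 : bit n k (lam j) = 1 := by omega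
      rw [if_neg hb] at hQ hneg
      have ha := hlow ((1 + -c) / 2) (by linarith) (by linarith)
      rw [hb1]
      refine ha.trans (abs_le_of_sq_le_sq' ?_ (norm_nonneg _)).2
      rw [hQ]
  -- The `8` in `ampError` splits as `2 · 4`: squared block distance at most `2 δ_amp`, and `δ / 2`
  -- because passing to channels doubles the distance.
  have herr : 2 * ampError m δ ≤ (δ / 2) ^ 2 := by
    have : 0 < (10 : ℝ) ^ (-m) := by positivity
    unfold ampError
    nlinarith [sq_nonneg δ]
  have hclose : ∀ q, ‖w q - v q‖ ≤ δ / 2 := by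
    intro q
    simp only [hv]
    split_ifs with hq
    · obtain ⟨r, j⟩ := q
      obtain rfl : r = binary k (leastBits n k (lam j)) := hq
      refine (abs_le_of_sq_le_sq' ?_ (by positivity)).2
      refine (hvw j).trans ?_
      have h5 : 1 - ampError m δ ≤ _ := hentry j
      linarith
    · rw [sub_self, norm_zero]
      positivity
  have hone : ∀ {u : (Fin k → Fin 2) × J → Matrix (Fin 2) (Fin 2) ℂ},
      (∀ q, u q ∈ Matrix.unitaryGroup (Fin 2) ℂ) → ‖frameOperator ψ u‖ ≤ 1 := fun hu =>
    l2_opNorm_le_one_of_conjTranspose_mul_self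
      (Matrix.mem_unitaryGroup_iff'.1 (frameOperator_mem_unitaryGroup ψ hu))
  refine ⟨⟨frameOperator ψ v, frameOperator_mem_unitaryGroup ψ hvU⟩, φ', fun j => ?_, ?_⟩
  · refine frameOperator_mulVec_registerState ψ v _ _ _ j fun a => ?_
    rw [← hv' j a]
    simp [hv]
  · rw [hacts.toMatrix_eq]
    refine (diamondNorm_unitaryChannel_sub_le _ _ (hone hwU) (hone hvU)).trans
      (ENNReal.ofReal_le_ofReal ?_)
    have := norm_frameOperator_sub_le ψ (by positivity) hclose
    change 2 * ‖frameOperator ψ w - frameOperator ψ v‖ ≤ δ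
    linarith

end Correctness

/-! ### Modified Bessel functions -/

section Bessel

lemma summable_besselI (j : ℕ) (t : ℝ) :
    Summable fun i : ℕ => (t / 2) ^ (2 * i + j) / ((i.factorial : ℝ) * ((i + j).factorial : ℝ)) := by
  refine Summable.of_norm_bounded
    ((Real.summable_pow_div_factorial ((t / 2) ^ 2)).mul_left (|t / 2| ^ j)) fun i => ?_
  have h1 : (1 : ℝ) ≤ ((i + j).factorial : ℝ) := by
    exact_mod_cast (i + j).factorial_pos
  have h2 : (0 : ℝ) < i.factorial := by exact_mod_cast Nat.factorial_pos i
  rw [norm_div, norm_pow, Real.norm_eq_abs, Real.norm_of_nonneg (by positivity), pow_add, pow_mul,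
    sq_abs, ← mul_div_assoc, mul_comm (((t / 2) ^ 2) ^ i)]
  gcongr
  exact le_mul_of_one_le_right h2.le h1

lemma besselI_pos (j : ℕ) {t : ℝ} (ht : 0 < t) : 0 < besselI j t :=
  (summable_besselI j t).tsum_pos (fun i => by positivity) 0 (by positivity)

/-- Pairs of natural numbers, parametrized by their difference and their minimum. -/
def differenceEquiv : ℤ × ℕ ≃ ℕ × ℕ where
  toFun p := (p.2 + p.1.toNat, p.2 + (-p.1).toNat)
  invFun p := ((p.1 : ℤ) - p.2, min p.1 p.2)
  left_inv p := by
    obtain ⟨m, i⟩ := p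
    simp only [Prod.mk.injEq]
    omega
  right_inv p := by
    obtain ⟨a, b⟩ := p
    simp only [Prod.mk.injEq]
    omega

lemma exp_term_mul_exp_term (t : ℝ) {w : ℂ} (hw : w ≠ 0) (m : ℤ) (i : ℕ) :
    ((t / 2 : ℝ) * w) ^ (i + m.toNat) / (i + m.toNat).factorial *
      (((t / 2 : ℝ) * w⁻¹) ^ (i + (-m).toNat) / (i + (-m).toNat).factorial) =
    (((t / 2) ^ (2 * i + m.natAbs) / ((i.factorial : ℝ) * ((i + m.natAbs).factorial : ℝ)) : ℝ) : ℂ)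
      * w ^ m := by
  have hf : ∀ n : ℕ, ((n.factorial : ℕ) : ℂ) ≠ 0 := fun n => by exact_mod_cast n.factorial_ne_zero
  generalize t / 2 = c
  obtain ⟨j, rfl | rfl⟩ := m.eq_nat_or_neg
  · have e1 : (j : ℤ).toNat = j := by omega
    have e2 : (-(j : ℤ)).toNat = 0 := by omega
    rw [e1, e2, Int.natAbs_natCast, zpow_natCast, Nat.add_zero]
    push_cast
    have := hf i
    have := hf (i + j)
    generalize ((i + j).factorial : ℂ) = x at *
    generalize (i.factorial : ℂ) = y at *
    rw [div_mul_div_comm, div_mul_eq_mul_div, mul_comm x y]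
    congr 1
    rw [mul_pow, mul_pow, inv_pow, pow_add w]
    have := pow_ne_zero i hw
    field_simp
    ring
  · have e1 : (-(j : ℤ)).toNat = 0 := by omega
    have e2 : (- -(j : ℤ)).toNat = j := by omega
    rw [e1, e2, Int.natAbs_neg, Int.natAbs_natCast, zpow_neg, zpow_natCast, Nat.add_zero]
    push_cast
    have := hf i
    have := hf (i + j)
    generalize ((i + j).factorial : ℂ) = x at *
    generalize (i.factorial : ℂ) = y at *
    rw [div_mul_div_comm, div_mul_eq_mul_div]
    congr 1
    rw [mul_pow, mul_pow, inv_pow, pow_add w]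
    have := pow_ne_zero i hw
    have := pow_ne_zero j hw
    field_simp
    ring

lemma hasSum_exp_add (x y : ℂ) :
    HasSum (fun p : ℤ × ℕ => x ^ (p.2 + p.1.toNat) / (p.2 + p.1.toNat).factorial *
      (y ^ (p.2 + (-p.1).toNat) / (p.2 + (-p.1).toNat).factorial)) (Complex.exp (x + y)) := by
  have hexp : ∀ x : ℂ, HasSum (fun n : ℕ => x ^ n / n.factorial) (Complex.exp x) := fun x => by
    rw [Complex.exp_eq_exp_ℂ]
    exact NormedSpace.expSeries_div_hasSum_exp x
  have hn : ∀ x : ℂ, Summable fun n : ℕ => ‖x ^ n / n.factorial‖ := fun x =>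
    NormedSpace.norm_expSeries_div_summable x
  have h := summable_mul_of_summable_norm (hn x) (hn y)
  have h2 := HasSum.mul (hexp x) (hexp y) h
  rw [← Complex.exp_add] at h2
  exact differenceEquiv.hasSum_iff.2 h2

/-- The generating function of the modified Bessel functions. -/
lemma hasSum_besselI_mul_zpow (t : ℝ) {w : ℂ} (hw : w ≠ 0) :
    HasSum (fun m : ℤ => (besselI m.natAbs t : ℂ) * w ^ m)
      (Complex.exp ((t / 2 : ℝ) * (w + w⁻¹))) := by
  have h : HasSum (fun p : ℤ × ℕ => (((t / 2) ^ (2 * p.2 + p.1.natAbs) /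
      ((p.2.factorial : ℝ) * ((p.2 + p.1.natAbs).factorial : ℝ)) : ℝ) : ℂ) * w ^ p.1)
      (Complex.exp ((t / 2 : ℝ) * (w + w⁻¹))) := by
    rw [mul_add]
    refine (hasSum_exp_add _ _).congr_fun fun p => ?_
    exact (exp_term_mul_exp_term t hw p.1 p.2).symm
  exact h.prod_fiberwise fun m =>
    (Complex.hasSum_ofReal.2 (summable_besselI m.natAbs t).hasSum).mul_right (w ^ m)

/-- Chernoff bound: at `w = e^s` the generating function is `e^{t cosh s}`, all its terms are
nonnegative, and those beyond `N` carry a weight of at least `e^{sN}`. -/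
lemma sum_besselI_le {t s : ℝ} (ht : 0 < t) (hs : 0 ≤ s) (N K : ℕ) :
    ∑ j ∈ Finset.Ioc N K, besselI j t ≤ Real.exp (t * Real.cosh s - s * N) := by
  have h := hasSum_besselI_mul_zpow t (w := (Real.exp s : ℝ))
    (by exact_mod_cast (Real.exp_pos s).ne')
  have h1 : Complex.exp ((t / 2 : ℝ) * (((Real.exp s : ℝ) : ℂ) + ((Real.exp s : ℝ) : ℂ)⁻¹)) =
      ((Real.exp (t * Real.cosh s) : ℝ) : ℂ) := by
    rw [Real.cosh_eq, Real.exp_neg]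
    push_cast
    congr 1
    ring
  rw [h1] at h
  have h2 : HasSum (fun m : ℤ => besselI m.natAbs t * Real.exp s ^ m)
      (Real.exp (t * Real.cosh s)) := by
    rw [← Complex.hasSum_ofReal]
    push_cast at h ⊢
    exact h
  have h3 := sum_le_hasSum ((Finset.Ioc N K).map Nat.castEmbedding)
    (fun m _ => mul_nonneg (besselI_pos _ ht).le (by positivity)) h2
  rw [Finset.sum_map] at h3
  rw [Real.exp_sub, le_div_iff₀ (Real.exp_pos _), Finset.sum_mul]
  refine le_trans (Finset.sum_le_sum fun j hj => ?_) h3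
  simp only [Nat.castEmbedding_apply, Int.natAbs_natCast, zpow_natCast, ← Real.exp_nat_mul]
  have := (Finset.mem_Ioc.1 hj).1.le
  refine mul_le_mul_of_nonneg_left (Real.exp_le_exp.2 ?_) (besselI_pos j ht).le
  · rw [mul_comm s]
    exact mul_le_mul_of_nonneg_right (by exact_mod_cast this) hs

/-- The generating function at `w = -e^{iφ}`, with `m` and `-m` paired. Pairing counts `m = 0`
twice, whence the extra `besselI 0 t`. -/
lemma hasSum_besselI_mul_cos (t φ : ℝ) :
    HasSum (fun j : ℕ => 2 * (besselI j t * (-1) ^ j * Real.cos (j * φ)))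
      (Real.exp (-(t * Real.cos φ)) + besselI 0 t) := by
  have h := hasSum_besselI_mul_zpow t (w := -Complex.exp (φ * Complex.I))
    (neg_ne_zero.2 (Complex.exp_ne_zero _))
  have h1 : Complex.exp ((t / 2 : ℝ) * (-Complex.exp (φ * Complex.I) +
      (-Complex.exp (φ * Complex.I))⁻¹)) = ((Real.exp (-(t * Real.cos φ)) : ℝ) : ℂ) := by
    rw [inv_neg, ← Complex.exp_neg]
    push_cast
    rw [Complex.cos, ← neg_mul]
    congr 1
    ring
  rw [h1] at h
  have h2 := Complex.hasSum_re h.nat_add_neg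
  convert! h2 using 2 with j
  · have hz : (-Complex.exp (φ * Complex.I)) ^ (j : ℤ) + (-Complex.exp (φ * Complex.I)) ^ (-j : ℤ) =
        ((2 * ((-1) ^ j * Real.cos (j * φ)) : ℝ) : ℂ) := by
      rw [zpow_neg, zpow_natCast, ← inv_pow, inv_neg, ← Complex.exp_neg, neg_pow,
        neg_pow (Complex.exp _), ← Complex.exp_nat_mul, ← Complex.exp_nat_mul]
      push_cast
      rw [Complex.cos]
      ring_nf
    rw [Int.natAbs_neg, Int.natAbs_natCast, ← mul_add, hz, ← Complex.ofReal_mul,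
      Complex.ofReal_re]
    ring
  · rw [Complex.add_re, Complex.ofReal_re]
    simp

/-- The truncated cosine series. -/
lemma abs_exp_sub_cos_series_le {t s : ℝ} (ht : 0 < t) (hs : 0 ≤ s) (N : ℕ) (φ : ℝ) :
    |Real.exp (-(t * Real.cos φ)) - (besselI 0 t +
      ∑ j ∈ Finset.Icc 1 N, 2 * (besselI j t * (-1) ^ j * Real.cos (j * φ)))| ≤
      2 * Real.exp (t * Real.cosh s - s * N) := by
  set F : ℕ → ℝ := fun j => 2 * (besselI j t * (-1) ^ j * Real.cos (j * φ)) with hF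
  have h := (hasSum_besselI_mul_cos t φ).tendsto_sum_nat
  have h0 : ∀ n, ∑ j ∈ Finset.range (n + 1), F j =
      2 * besselI 0 t + ∑ j ∈ Finset.Icc 1 n, F j := fun n => by
    rw [Finset.range_eq_Ico, Finset.sum_eq_sum_Ico_succ_bot (by omega)]
    rw [zero_add, ← Finset.Ico_add_one_right_eq_Icc]
    simp [hF]
  have h1 : Filter.Tendsto (fun n => |∑ j ∈ Finset.range (n + 1), F j -
      (2 * besselI 0 t + ∑ j ∈ Finset.Icc 1 N, F j)|) Filter.atTop
      (nhds |Real.exp (-(t * Real.cos φ)) + besselI 0 t -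
        (2 * besselI 0 t + ∑ j ∈ Finset.Icc 1 N, F j)|) :=
    ((h.comp (Filter.tendsto_add_atTop_nat 1)).sub_const _).abs
  have h2 : Real.exp (-(t * Real.cos φ)) - (besselI 0 t + ∑ j ∈ Finset.Icc 1 N, F j) =
      Real.exp (-(t * Real.cos φ)) + besselI 0 t -
        (2 * besselI 0 t + ∑ j ∈ Finset.Icc 1 N, F j) := by ring
  rw [h2]
  refine le_of_tendsto h1 ?_
  filter_upwards [Filter.eventually_ge_atTop N] with n hn
  have h3 : ∑ j ∈ Finset.Icc 1 n, F j - ∑ j ∈ Finset.Icc 1 N, F j =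
      ∑ j ∈ Finset.Ioc N n, F j := by
    rw [sub_eq_iff_eq_add, add_comm, ← Finset.sum_union]
    · congr 1
      ext j
      simp only [Finset.mem_Icc, Finset.mem_union, Finset.mem_Ioc]
      omega
    · rw [Finset.disjoint_left]
      intro j
      simp only [Finset.mem_Icc, Finset.mem_Ioc]
      omega
  rw [h0, add_sub_add_left_eq_sub, h3]
  refine (Finset.abs_sum_le_sum_abs _ _).trans ?_
  refine le_trans (Finset.sum_le_sum fun j _ => ?_) ((Finset.mul_sum _ _ (2 : ℝ)).symm.le.trans
    (mul_le_mul_of_nonneg_left (sum_besselI_le ht hs N n) zero_le_two))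
  rw [hF, abs_mul, abs_mul, abs_mul, abs_pow, abs_neg, abs_one, one_pow, mul_one,
    abs_of_pos (besselI_pos j ht), abs_two]
  have := (besselI_pos j ht).le
  exact mul_le_mul_of_nonneg_left (mul_le_of_le_one_right this (Real.abs_cos_le_one _)) zero_le_two

end Bessel

/-! ### The error function -/

section ErrorFunction

open MeasureTheory Filter Topology

/-- The error function. -/
def erf (y : ℝ) : ℝ := 2 / Real.sqrt Real.pi * ∫ u in (0 : ℝ)..y, Real.exp (-u ^ 2)

lemma continuous_exp_neg_sq : Continuous fun u : ℝ => Real.exp (-u ^ 2) := by fun_prop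

lemma hasDerivAt_erf (y : ℝ) :
    HasDerivAt erf (2 / Real.sqrt Real.pi * Real.exp (-y ^ 2)) y :=
  ((continuous_exp_neg_sq.integral_hasStrictDerivAt 0 y).hasDerivAt).const_mul _

lemma erf_zero : erf 0 = 0 := by simp [erf]

lemma erf_neg (y : ℝ) : erf (-y) = -erf y := by
  have h := intervalIntegral.integral_comp_neg (a := 0) (b := y) fun u => Real.exp (-u ^ 2)
  simp only [neg_zero, even_two.neg_pow] at h
  rw [erf, erf, h, intervalIntegral.integral_symm]
  ring

lemma tendsto_erf : Tendsto erf atTop (𝓝 1) := by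
  have h : IntegrableOn (fun u : ℝ => Real.exp (-u ^ 2)) (Set.Ioi 0) := by
    simpa using (integrable_exp_neg_mul_sq one_pos).integrableOn
  have h1 := (intervalIntegral_tendsto_integral_Ioi 0 h tendsto_id).const_mul
    (2 / Real.sqrt Real.pi)
  have h2 : ∫ u in Set.Ioi (0 : ℝ), Real.exp (-u ^ 2) = Real.sqrt Real.pi / 2 := by
    simpa using integral_gaussian_Ioi 1
  have h3 : 0 < Real.sqrt Real.pi := Real.sqrt_pos.2 Real.pi_pos
  have h4 : 2 / Real.sqrt Real.pi * (Real.sqrt Real.pi / 2) = 1 := by field_simp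
  rw [h2, h4] at h1
  exact h1

lemma monotone_erf : Monotone erf :=
  monotone_of_deriv_nonneg (fun y => (hasDerivAt_erf y).differentiableAt) fun y => by
    rw [(hasDerivAt_erf y).deriv]
    positivity

lemma erf_le_one (y : ℝ) : erf y ≤ 1 := monotone_erf.ge_of_tendsto tendsto_erf y

lemma abs_erf_le_one (y : ℝ) : |erf y| ≤ 1 :=
  abs_le.2 ⟨by linarith [erf_neg y, erf_le_one (-y)], erf_le_one y⟩

/-- Shift the tail integral by `y` and use `(u + y)² ≥ u² + y²` for `u ≥ 0`: the Gaussian tail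
beyond `y` is at most `e^{-y²}` times the full half-line integral. -/
lemma one_sub_exp_le_erf {y : ℝ} (hy : 0 ≤ y) : 1 - Real.exp (-y ^ 2) ≤ erf y := by
  have h1 : ∀ R : ℝ, 0 ≤ R → erf (R + y) ≤ erf y + Real.exp (-y ^ 2) := by
    intro R hR
    have hint : ∀ a b : ℝ, IntervalIntegrable (fun u : ℝ => Real.exp (-u ^ 2)) volume a b :=
      fun a b => continuous_exp_neg_sq.intervalIntegrable a b
    have h2 := intervalIntegral.integral_add_adjacent_intervals (hint 0 y) (hint y (R + y))
    have h3 := intervalIntegral.integral_comp_add_right (a := 0) (b := R)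
      (fun u => Real.exp (-u ^ 2)) y
    rw [zero_add] at h3
    have h4 : ∫ u in (0 : ℝ)..R, Real.exp (-(u + y) ^ 2) ≤
        ∫ u in (0 : ℝ)..R, Real.exp (-y ^ 2) * Real.exp (-u ^ 2) := by
      refine intervalIntegral.integral_mono_on hR
        (Continuous.intervalIntegrable (by fun_prop) _ _)
        (Continuous.intervalIntegrable (by fun_prop) _ _) fun u hu => ?_
      rw [← Real.exp_add]
      have := hu.1
      gcongr
      nlinarith [mul_nonneg hu.1 hy]
    rw [intervalIntegral.integral_const_mul] at h4
    have h5 := erf_le_one R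
    have hc : 0 ≤ 2 / Real.sqrt Real.pi := by positivity
    have h6 := mul_le_mul_of_nonneg_left h4 hc
    have h7 := mul_le_mul_of_nonneg_left h5 (Real.exp_pos (-y ^ 2)).le
    unfold erf at h7 ⊢
    rw [← h2, ← h3, mul_add]
    linarith
  have h8 : Tendsto (fun R => erf (R + y)) atTop (𝓝 1) :=
    tendsto_erf.comp (tendsto_atTop_add_const_right _ y tendsto_id)
  have h9 : (1 : ℝ) ≤ erf y + Real.exp (-y ^ 2) := by
    refine le_of_tendsto h8 ?_
    filter_upwards [eventually_ge_atTop 0] with R hR using h1 R hR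
  linarith

end ErrorFunction

/-! ### The Chebyshev approximation of the error function -/

section SignPoly

open Polynomial Filter Topology

/-- From `T_n' = n U_{n-1}` and `U_{2j} - U_{2j-2} = 2 T_{2j}`. The summands of `signPoly` are thus
primitives of even Chebyshev polynomials. -/
lemma derivative_chebyshev_difference {j : ℕ} (hj : 1 ≤ j) :
    derivative (C (1 / (2 * (j : ℝ) + 1)) * Chebyshev.T ℝ (2 * (j : ℤ) + 1) -
      C (1 / (2 * (j : ℝ) - 1)) * Chebyshev.T ℝ (2 * (j : ℤ) - 1)) =
    2 * Chebyshev.T ℝ (2 * (j : ℤ)) := by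
  have hj' : (1 : ℝ) ≤ j := by exact_mod_cast hj
  have e1 : C (1 / (2 * (j : ℝ) + 1)) * ((2 * (j : ℤ) + 1 : ℤ) : ℝ[X]) = 1 := by
    rw [← C_eq_intCast, ← C_mul, ← C_1]
    congr 1
    push_cast
    field_simp
  have e2 : C (1 / (2 * (j : ℝ) - 1)) * ((2 * (j : ℤ) - 1 : ℤ) : ℝ[X]) = 1 := by
    rw [← C_eq_intCast, ← C_mul, ← C_1]
    congr 1
    push_cast
    have : 2 * (j : ℝ) - 1 ≠ 0 := by linarith
    field_simp
  have h := Chebyshev.two_mul_T_eq_U_sub_U ℝ (2 * (j : ℤ) - 2)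
  rw [sub_add_cancel] at h
  rw [derivative_sub, derivative_C_mul, derivative_C_mul, Chebyshev.T_derivative_eq_U,
    Chebyshev.T_derivative_eq_U, ← mul_assoc, ← mul_assoc, e1, e2, one_mul, one_mul, h,
    add_sub_cancel_right, sub_sub]
  rfl

/-- The prefactor of the approximation. -/
def signPolyScale (κ : ℝ) : ℝ := 2 * κ * Real.exp (-(κ ^ 2 / 2)) / Real.sqrt Real.pi

lemma eval_derivative_signPoly (κ : ℝ) (N : ℕ) (φ : ℝ) :
    (derivative (signPoly κ N)).eval (Real.cos φ) =
      signPolyScale κ * (besselI 0 (κ ^ 2 / 2) + ∑ j ∈ Finset.Icc 1 N,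
        2 * (besselI j (κ ^ 2 / 2) * (-1) ^ j * Real.cos (j * (2 * φ)))) := by
  rw [signPoly, derivative_C_mul, derivative_add, derivative_C_mul, derivative_X, mul_one,
    derivative_sum, eval_mul, eval_C, eval_add, eval_C, eval_finsetSum]
  refine congrArg₂ _ rfl (congrArg₂ _ rfl (Finset.sum_congr rfl fun j hj => ?_))
  rw [derivative_C_mul, derivative_chebyshev_difference (Finset.mem_Icc.1 hj).1, eval_mul, eval_C,
    eval_mul, eval_ofNat, Chebyshev.T_real_cos]
  push_cast
  ring_nf

/-- With `x = cos φ`, `cos 2φ = 2x² - 1`, so the Gaussian is `e^{-κ²/2}` times `e^{-(κ²/2) cos 2φ}`,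
whose cosine series is the one truncated in the derivative. -/
lemma abs_eval_derivative_signPoly_sub_le {κ s : ℝ} (hκ : 0 < κ) (hs : 0 ≤ s) (N : ℕ) {x : ℝ}
    (hx : |x| ≤ 1) :
    |(derivative (signPoly κ N)).eval x -
      2 / Real.sqrt Real.pi * Real.exp (-(κ * x) ^ 2) * κ| ≤
      signPolyScale κ * (2 * Real.exp (κ ^ 2 / 2 * Real.cosh s - s * N)) := by
  obtain ⟨hx1, hx2⟩ := abs_le.1 hx
  have h := abs_exp_sub_cos_series_le (t := κ ^ 2 / 2) (by positivity) hs N (2 * Real.arccos x)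
  have hd := eval_derivative_signPoly κ N (Real.arccos x)
  rw [Real.cos_arccos hx1 hx2] at hd
  have hc : 0 ≤ signPolyScale κ := by unfold signPolyScale; positivity
  have he : 2 / Real.sqrt Real.pi * Real.exp (-(κ * x) ^ 2) * κ =
      signPolyScale κ * Real.exp (-(κ ^ 2 / 2 * Real.cos (2 * Real.arccos x))) := by
    rw [Real.cos_two_mul, Real.cos_arccos hx1 hx2, signPolyScale]
    have : Real.exp (-(κ * x) ^ 2) = Real.exp (-(κ ^ 2 / 2)) *
        Real.exp (-(κ ^ 2 / 2 * (2 * x ^ 2 - 1))) := by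
      rw [← Real.exp_add]
      ring_nf
    rw [this]
    ring
  rw [hd, he, ← mul_sub, abs_mul, abs_of_nonneg hc, abs_sub_comm]
  exact mul_le_mul_of_nonneg_left h hc

lemma eval_zero_signPoly (κ : ℝ) (N : ℕ) : (signPoly κ N).eval 0 = 0 := by
  have h1 : ∀ j : ℤ, (Chebyshev.T ℝ (2 * j + 1)).eval 0 = 0 := fun j =>
    Chebyshev.T_eval_zero_of_odd ℝ ⟨j, rfl⟩
  have h2 : ∀ j : ℤ, (Chebyshev.T ℝ (2 * j - 1)).eval 0 = 0 := fun j =>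
    Chebyshev.T_eval_zero_of_odd ℝ ⟨j - 1, by ring⟩
  simp [signPoly, eval_finsetSum, h1, h2]

/-- Integrates the derivative bound from `0`. It serves only to identify the limit as `N → ∞`; it
lacks the factor `1 / (2N + 1)` that later absorbs `κ`. -/
lemma abs_eval_signPoly_sub_erf_le {κ s : ℝ} (hκ : 0 < κ) (hs : 0 ≤ s) (N : ℕ) {x : ℝ}
    (hx : |x| ≤ 1) :
    |(signPoly κ N).eval x - erf (κ * x)| ≤
      signPolyScale κ * (2 * Real.exp (κ ^ 2 / 2 * Real.cosh s - s * N)) := by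
  set B := signPolyScale κ * (2 * Real.exp (κ ^ 2 / 2 * Real.cosh s - s * N)) with hB
  have hB0 : 0 ≤ B := by rw [hB]; unfold signPolyScale; positivity
  have hder : ∀ y ∈ Set.Icc (-1 : ℝ) 1, HasDerivWithinAt
      (fun y => (signPoly κ N).eval y - erf (κ * y))
      ((derivative (signPoly κ N)).eval y - 2 / Real.sqrt Real.pi * Real.exp (-(κ * y) ^ 2) * κ)
      (Set.Icc (-1 : ℝ) 1) y := fun y _ => by
    refine (((signPoly κ N).hasDerivAt y).sub ?_).hasDerivWithinAt
    have h1 : HasDerivAt (fun y => κ * y) κ y := by simpa using (hasDerivAt_id y).const_mul κ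
    exact (hasDerivAt_erf (κ * y)).comp y h1
  have h := (convex_Icc (-1 : ℝ) 1).norm_image_sub_le_of_norm_hasDerivWithin_le hder
    (fun y hy => abs_eval_derivative_signPoly_sub_le hκ hs N (abs_le.2 hy))
    (x := 0) (y := x) (by simp) (abs_le.1 hx)
  simp only [eval_zero_signPoly, mul_zero, erf_zero, sub_zero, Real.norm_eq_abs] at h
  exact h.trans (mul_le_of_le_one_right hB0 hx)

lemma tendsto_eval_signPoly {κ : ℝ} (hκ : 0 < κ) {x : ℝ} (hx : |x| ≤ 1) :
    Tendsto (fun N => (signPoly κ N).eval x) atTop (𝓝 (erf (κ * x))) := by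
  rw [tendsto_iff_norm_sub_tendsto_zero]
  refine squeeze_zero (fun _ => norm_nonneg _)
    (fun N => abs_eval_signPoly_sub_erf_le hκ zero_le_one N hx) ?_
  have h : Tendsto (fun N : ℕ => Real.exp (κ ^ 2 / 2 * Real.cosh 1 - 1 * (N : ℝ))) atTop (𝓝 0) := by
    refine Real.tendsto_exp_atBot.comp ?_
    simp only [one_mul, sub_eq_add_neg]
    exact tendsto_atBot_add_const_left _ _
      (tendsto_neg_atTop_atBot.comp tendsto_natCast_atTop_atTop)
  simpa using (h.const_mul 2).const_mul (signPolyScale κ)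

/-- Bounding the integrated terms directly by `|T_n| ≤ 1` retains the denominators `2j ± 1 ≥ 2N +
1`. -/
lemma abs_eval_signPoly_sub_le {κ s : ℝ} (hκ : 0 < κ) (hs : 0 ≤ s) {N K : ℕ} (hNK : N ≤ K)
    {x : ℝ} (hx : |x| ≤ 1) :
    |(signPoly κ K).eval x - (signPoly κ N).eval x| ≤ signPolyScale κ *
      (2 / (2 * N + 1) * Real.exp (κ ^ 2 / 2 * Real.cosh s - s * N)) := by
  have hc : 0 ≤ signPolyScale κ := by unfold signPolyScale; positivity
  have ht : 0 < κ ^ 2 / 2 := by positivity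
  have hsum : Finset.Icc 1 K = Finset.Icc 1 N ∪ Finset.Ioc N K := by
    ext j
    simp only [Finset.mem_Icc, Finset.mem_union, Finset.mem_Ioc]
    omega
  have hdisj : Disjoint (Finset.Icc 1 N) (Finset.Ioc N K) := by
    rw [Finset.disjoint_left]
    intro j
    simp only [Finset.mem_Icc, Finset.mem_Ioc]
    omega
  have h1 : (signPoly κ K).eval x - (signPoly κ N).eval x = signPolyScale κ *
      ∑ j ∈ Finset.Ioc N K, besselI j (κ ^ 2 / 2) * (-1) ^ j *
        (1 / (2 * (j : ℝ) + 1) * (Chebyshev.T ℝ (2 * (j : ℤ) + 1)).eval x -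
          1 / (2 * (j : ℝ) - 1) * (Chebyshev.T ℝ (2 * (j : ℤ) - 1)).eval x) := by
    rw [signPoly, signPoly, hsum, Finset.sum_union hdisj, signPolyScale]
    simp only [eval_mul, eval_add, eval_sub, eval_C, eval_finsetSum]
    ring
  rw [h1, abs_mul, abs_of_nonneg hc]
  refine mul_le_mul_of_nonneg_left ?_ hc
  refine (Finset.abs_sum_le_sum_abs _ _).trans ?_
  refine le_trans (Finset.sum_le_sum fun j hj => ?_) ((Finset.mul_sum _ _ _).symm.le.trans
    (mul_le_mul_of_nonneg_left (sum_besselI_le ht hs N K) (by positivity)))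
  have hNj : (N : ℝ) + 1 ≤ j := by exact_mod_cast (Finset.mem_Ioc.1 hj).1
  have hN0 : (0 : ℝ) ≤ N := N.cast_nonneg
  rw [abs_mul, abs_mul, abs_pow, abs_neg, abs_one, one_pow, mul_one,
    abs_of_pos (besselI_pos j ht), mul_comm]
  refine mul_le_mul_of_nonneg_right ?_ (besselI_pos j ht).le
  have hT : ∀ (n : ℤ) (a : ℝ), 2 * (N : ℝ) + 1 ≤ a →
      |1 / a * (Chebyshev.T ℝ n).eval x| ≤ 1 / (2 * N + 1) := fun n a ha => by
    have ha0 : 0 < a := by linarith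
    rw [abs_mul, abs_of_pos (by positivity)]
    calc _ ≤ 1 / a * 1 := by
          gcongr
          exact Chebyshev.abs_eval_T_real_le_one n hx
      _ ≤ _ := by
          rw [mul_one]
          gcongr
  refine (abs_sub _ _).trans ((add_le_add (hT _ _ (by linarith)) (hT _ _ (by linarith))).trans
    (le_of_eq (by ring)))

/-- The quantitative approximation of the error function. -/
theorem abs_erf_sub_eval_signPoly_le {κ s : ℝ} (hκ : 0 < κ) (hs : 0 ≤ s) (N : ℕ) {x : ℝ}
    (hx : |x| ≤ 1) :
    |erf (κ * x) - (signPoly κ N).eval x| ≤ signPolyScale κ *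
      (2 / (2 * N + 1) * Real.exp (κ ^ 2 / 2 * Real.cosh s - s * N)) := by
  refine le_of_tendsto ((tendsto_eval_signPoly hκ hx).sub_const _).abs ?_
  filter_upwards [eventually_ge_atTop N] with K hK using abs_eval_signPoly_sub_le hκ hs hK hx

lemma natDegree_signPoly {κ : ℝ} (hκ : 0 < κ) (N : ℕ) : (signPoly κ N).natDegree = 2 * N + 1 := by
  have ht : 0 < κ ^ 2 / 2 := by positivity
  have hc : 2 * κ * Real.exp (-(κ ^ 2 / 2)) / Real.sqrt Real.pi ≠ 0 := by positivity
  rw [signPoly, natDegree_C_mul hc]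
  clear hc
  induction N with
  | zero => simp [natDegree_C_mul_X _ (besselI_pos 0 ht).ne']
  | succ N ih =>
    rw [Finset.sum_Icc_succ_top (by omega), ← add_assoc]
    have hb := (besselI_pos (N + 1) ht).ne'
    have h1 : (2 * ((N + 1 : ℕ) : ℝ) + 1) ≠ 0 := by positivity
    have hdeg : (C (besselI (N + 1) (κ ^ 2 / 2) * (-1) ^ (N + 1)) *
        (C (1 / (2 * ((N + 1 : ℕ) : ℝ) + 1)) * Chebyshev.T ℝ (2 * ((N + 1 : ℕ) : ℤ) + 1) -
        C (1 / (2 * ((N + 1 : ℕ) : ℝ) - 1)) * Chebyshev.T ℝ (2 * ((N + 1 : ℕ) : ℤ) - 1))).natDegree =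
        2 * (N + 1) + 1 := by
      have h2 : (C (1 / (2 * ((N + 1 : ℕ) : ℝ) + 1)) *
          Chebyshev.T ℝ (2 * ((N + 1 : ℕ) : ℤ) + 1)).natDegree = 2 * (N + 1) + 1 := by
        rw [natDegree_C_mul (one_div_ne_zero h1), Chebyshev.natDegree_T]
        omega
      have h3 : (C (1 / (2 * ((N + 1 : ℕ) : ℝ) - 1)) *
          Chebyshev.T ℝ (2 * ((N + 1 : ℕ) : ℤ) - 1)).natDegree < 2 * (N + 1) + 1 := by
        refine (natDegree_C_mul_le _ _).trans_lt ?_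
        rw [Chebyshev.natDegree_T]
        omega
      rw [natDegree_C_mul (mul_ne_zero hb (by positivity)),
        natDegree_sub_eq_left_of_natDegree_lt (by rw [h2]; exact h3), h2]
    rw [natDegree_add_eq_right_of_natDegree_lt, hdeg]
    rw [ih, hdeg]
    omega

end SignPoly

/-! ### Choice of parameters for the amplifying polynomial -/

section Admissible

open Polynomial

lemma eval_ampPoly (η δ : ℝ) (M : ℕ) (x : ℝ) : (ampPoly η δ M).eval x =
    1 / 2 - 1 / 2 / (1 + δ / 2) * (signPoly (steepness η δ) ((M - 1) / 2)).eval (2 * x - 1) := by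
  simp [ampPoly, eval_comp]

lemma natDegree_ampPoly {η δ : ℝ} (hκ : 0 < steepness η δ) (hδ : 0 < δ) (N : ℕ) :
    (ampPoly η δ (2 * N + 1)).natDegree = 2 * N + 1 := by
  have hX : (2 * X - 1 : ℝ[X]).natDegree = 1 := by compute_degree!
  have h : (2 * N + 1 - 1) / 2 = N := by omega
  rw [ampPoly, natDegree_sub_eq_right_of_natDegree_lt, natDegree_C_mul (by positivity),
    natDegree_comp, hX, h, natDegree_signPoly hκ, mul_one]
  rw [natDegree_C, natDegree_C_mul (by positivity), natDegree_comp, hX, h, natDegree_signPoly hκ]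
  omega

lemma isAmplifyingDegree_of_approx {η δ : ℝ} (hδ : 0 < δ) (hη : 0 < η) (hη1 : η < 1 / 2)
    (hκ : 0 < steepness η δ) {N : ℕ}
    (happ : ∀ x : ℝ, |x| ≤ 1 →
      |erf (steepness η δ * x) - (signPoly (steepness η δ) N).eval x| ≤ δ / 2)
    (herf : 1 - δ ≤ erf (steepness η δ * (2 * η))) :
    IsAmplifyingDegree η δ (2 * N + 1) := by
  have hN : (2 * N + 1 - 1) / 2 = N := by omega
  have hpos : 0 < 1 + δ / 2 := by positivity
  have hev : ∀ x, (ampPoly η δ (2 * N + 1)).eval x =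
      (1 - (signPoly (steepness η δ) N).eval (2 * x - 1) / (1 + δ / 2)) / 2 := fun x => by
    rw [eval_ampPoly, hN]
    ring
  refine ⟨⟨N, rfl⟩, natDegree_ampPoly hκ hδ N, fun x h0 h1 => ?_, fun x h0 h1 => ?_,
    fun x h0 h1 => ?_⟩
  · have h2 := abs_le.1 (happ (2 * x - 1) (abs_le.2 ⟨by linarith, by linarith⟩))
    have h3 := abs_le.1 (abs_erf_le_one (steepness η δ * (2 * x - 1)))
    have h4 : (signPoly (steepness η δ) N).eval (2 * x - 1) / (1 + δ / 2) ≤ 1 := by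
      rw [div_le_one hpos]; linarith
    have h5 : -1 ≤ (signPoly (steepness η δ) N).eval (2 * x - 1) / (1 + δ / 2) := by
      rw [le_div_iff₀ hpos]; linarith
    rw [hev]
    constructor <;> linarith
  · have h2 := abs_le.1 (happ (2 * x - 1) (abs_le.2 ⟨by linarith, by linarith⟩))
    have h3 : erf (steepness η δ * (2 * x - 1)) ≤ -erf (steepness η δ * (2 * η)) := by
      rw [← erf_neg]
      exact monotone_erf (by nlinarith)
    -- The two errors give `-(1 - 3δ/2)` before rescaling, and `(1 - 2δ)(1 + δ/2) ≤ 1 - 3δ/2`.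
    have h4 : (signPoly (steepness η δ) N).eval (2 * x - 1) / (1 + δ / 2) ≤ -(1 - 2 * δ) := by
      rw [div_le_iff₀ hpos]; nlinarith
    rw [hev]
    linarith
  · have h2 := abs_le.1 (happ (2 * x - 1) (abs_le.2 ⟨by linarith, by linarith⟩))
    have h3 : erf (steepness η δ * (2 * η)) ≤ erf (steepness η δ * (2 * x - 1)) :=
      monotone_erf (by nlinarith)
    have h4 : 1 - 2 * δ ≤ (signPoly (steepness η δ) N).eval (2 * x - 1) / (1 + δ / 2) := by
      rw [le_div_iff₀ hpos]; nlinarith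
    rw [hev]
    linarith

theorem exists_isAmplifyingDegree {η δ : ℝ} (hη : 0 < η) (hη1 : η < 1 / 2) (hδ : 0 < δ)
    (hδ1 : δ < 1 / 2) :
    ∃ M : ℕ, IsAmplifyingDegree η δ M ∧ (M : ℝ) ≤ 11 * (η⁻¹ * Real.log δ⁻¹) := by
  set L := Real.log δ⁻¹ with hL
  have hδL : Real.exp (-L) = δ := by rw [hL, Real.log_inv, neg_neg, Real.exp_log hδ]
  have hL1 : 0.69 ≤ L := by
    have h1 : Real.log 2 ≤ L := Real.log_le_log two_pos (by
      rw [le_inv_comm₀ two_pos hδ]; linarith)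
    linarith [Real.log_two_gt_d9]
  -- Lets additive constants be absorbed: `2N + 1 ≤ 8 L/η + 3 ≤ 11 L/η`.
  have hLη : 1 ≤ L / η := by rw [le_div_iff₀ hη]; linarith
  set ℓ := Real.log (8 / (Real.pi * δ ^ 2)) with hℓ
  have hpi3 := Real.pi_gt_three
  have hpi4 := Real.pi_lt_four
  have hpow : ∀ n : ℕ, (n : ℝ) * L = Real.log (1 / δ ^ n) := fun n => by
    rw [hL, ← Real.log_pow, inv_pow, one_div]
  have hℓ2 : 2 * L ≤ ℓ := by
    have h := hpow 2
    push_cast at h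
    rw [h]
    refine Real.log_le_log (by positivity) ?_
    rw [div_le_div_iff₀ (by positivity) (by positivity)]
    nlinarith [sq_nonneg δ]
  have hℓ4 : ℓ ≤ 4 * L := by
    have h := hpow 4
    push_cast at h
    rw [h]
    refine Real.log_le_log (by positivity) ?_
    rw [div_le_div_iff₀ (by positivity) (by positivity)]
    have h1 : δ ^ 2 ≤ 1 / 4 := by nlinarith
    nlinarith [sq_nonneg δ, mul_nonneg (sq_nonneg δ) (sub_nonneg.2 h1)]
  set κ := steepness η δ with hκ
  have hκ2 : κ ^ 2 * (8 * η ^ 2) = ℓ := by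
    rw [hκ, steepness, mul_pow, div_pow, Real.sq_sqrt zero_le_two, ← hℓ,
      Real.sq_sqrt (by linarith)]
    field_simp
    ring
  have hκ0 : 0 < κ := by
    rw [hκ, steepness, ← hℓ]
    have : 0 < Real.sqrt ℓ := Real.sqrt_pos.2 (by linarith)
    positivity
  -- With `s = η` the exponent is `κ²/2 (cosh η - 1) - ηN ≤ κ²η²/2 - 4L`. As `κ²η² = ℓ/8 ≤ L/2`,
  -- this is below `-3L`, giving the factor `δ³`.
  set N := ⌈4 * (L / η)⌉₊ with hN
  have hN1 : 4 * (L / η) ≤ N := Nat.le_ceil _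
  have hN2 : (N : ℝ) < 4 * (L / η) + 1 := Nat.ceil_lt_add_one (by linarith)
  have hηN : 4 * L ≤ η * N := by
    have := mul_le_mul_of_nonneg_left hN1 hη.le
    have h2 : η * (4 * (L / η)) = 4 * L := by field_simp
    linarith
  have hκη : κ * η ≤ η * N := by
    refine le_trans (abs_le_of_sq_le_sq' (b := 4 * L) ?_ (by linarith)).2 hηN
    nlinarith
  have hκN : κ ≤ N := le_of_mul_le_mul_right (by linarith) hη
  have hcosh : Real.cosh η ≤ 1 + η ^ 2 := by
    have h1 := Real.cosh_le_exp_half_sq η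
    have h2 := Real.add_one_le_exp (-(η ^ 2 / 2))
    have h3 : Real.exp (η ^ 2 / 2) * Real.exp (-(η ^ 2 / 2)) = 1 := by
      rw [← Real.exp_add, add_neg_cancel, Real.exp_zero]
    have h4 : η ^ 2 ≤ 1 / 4 := by nlinarith
    nlinarith [Real.exp_pos (η ^ 2 / 2), sq_nonneg η]
  have hexp : Real.exp (-(κ ^ 2 / 2)) * Real.exp (κ ^ 2 / 2 * Real.cosh η - η * N) ≤ δ ^ 3 := by
    rw [← Real.exp_add, ← hδL, ← Real.exp_nat_mul]
    refine Real.exp_le_exp.2 ?_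
    push_cast
    have : κ ^ 2 / 2 * Real.cosh η ≤ κ ^ 2 / 2 * (1 + η ^ 2) := by gcongr
    nlinarith
  have hsqrt : 1 ≤ Real.sqrt Real.pi := Real.one_le_sqrt.2 (by linarith)
  refine ⟨2 * N + 1, isAmplifyingDegree_of_approx hδ hη hη1 hκ0 (fun x hx => ?_) ?_, ?_⟩
  · refine (abs_erf_sub_eval_signPoly_le hκ0 hη.le N hx).trans ?_
    have hN0 : (0 : ℝ) ≤ N := N.cast_nonneg
    have h1 : κ / Real.sqrt Real.pi * (4 / (2 * N + 1)) ≤ 2 := by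
      rw [div_mul_div_comm, div_le_iff₀ (by positivity)]
      nlinarith
    calc _ = κ / Real.sqrt Real.pi * (4 / (2 * N + 1)) *
          (Real.exp (-(κ ^ 2 / 2)) * Real.exp (κ ^ 2 / 2 * Real.cosh η - η * N)) := by
          rw [signPolyScale]; ring
      _ ≤ 2 * δ ^ 3 := by gcongr
      _ ≤ δ / 2 := by
          have h1 : δ ^ 2 ≤ 1 / 4 := by nlinarith
          nlinarith
  · refine le_trans ?_ (one_sub_exp_le_erf (by positivity))
    -- Here `(2κη)² = ℓ/2 ≥ L`.
    have h1 : Real.exp (-(κ * (2 * η)) ^ 2) ≤ δ := by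
      rw [← hδL]
      refine Real.exp_le_exp.2 ?_
      nlinarith
    linarith
  · push_cast
    have : η⁻¹ * L = L / η := by ring
    rw [this]
    linarith

end Admissible

end PhaseEst

end

theorem mainTheorem1 :
    -- Admissible degrees `M` exist and can be chosen `O(η⁻¹ log δ⁻¹)`.
    (∃ c : ℝ, 0 < c ∧ ∀ η δ : ℝ, 0 < η → η < 1 / 2 → 0 < δ → δ < 1 / 2 →
      ∃ M : ℕ, PhaseEst.IsAmplifyingDegree η δ M ∧ (M : ℝ) ≤ c * (η⁻¹ * Real.log δ⁻¹)) ∧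
    -- For every admissible `M` there is a circuit for the bit `k` with `2^(n-k) * M` queries.
    ∀ (n k : ℕ) (α δ m : ℝ), k < n → 0 < α → α < 1 → 0 < δ → 0 < m →
      ∀ M : ℕ, PhaseEst.IsAmplifyingDegree (PhaseEst.ampGap k α) (PhaseEst.ampError m δ) M →
        ∃ C : PhaseEst.Circuit (k + 1),
          C.queries = 2 ^ (n - k) * M ∧
          PhaseEst.IsIterativePhaseEstimatorWithPhases.{u, v} n α k δ C := by
  exact ⟨⟨11, by norm_num, fun _ _ hη hη1 hδ hδ1 =>
      PhaseEst.exists_isAmplifyingDegree hη hη1 hδ hδ1⟩,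
    fun _ _ _ _ _ hk h0 h1 hδ _ _ hM => PhaseEst.exists_circuit hk h0 h1 hδ hM⟩
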